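/- Let $n\ge 2$. Put $R^1=\{x\in\mathbb R^n: x_1\ge0,\,x_2\ge0\}$, $R^2=\{x_1>0,\,x_2<0\}$, $R^3=\{x_1<0,\,x_2<0\}$, $R^4=\{x_1<0,\,x_2>0\}$. Let $f^k,g^k:\mathbb R^n\to\mathbb R^n$ $(k=1,2,3,4)$ be $C^\infty$ and consider, for small real $\varepsilon$, the piecewise smooth system $$\dot x=f^k(x)+\varepsilon g^k(x),\qquad x\in R^k,\ k=1,2,3,4. \tag{$S_\varepsilon$}$$ The switching planes are divided into the four pieces $\Sigma_A=\{x_1=0,x_2>0\}$, $\Sigma_B=\{x_2=0,x_1>0\}$, $\Sigma_C=\{x_1=0,x_2<0\}$, $\Sigma_E=\{x_2=0,x_1<0\}$. An *arc* of the $k$-th subsystem is a solution on some $[0,\tau]$, $\tau>0$, of $\dot x=f^k+\varepsilon g^k$ that lies in the interior of $R^k$ for $0<t<\tau$ and leads from $\Sigma_A$ to $\Sigma_B$ ($k=1$), from $\Sigma_B$ to $\Sigma_C$ ($k=2$), from $\Sigma_C$ to $\Sigma_E$ ($k=3$), from $\Sigma_E$ to $\Sigma_A$ ($k=4$). A *periodic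 orbit* of $(S_\varepsilon)$ means here a closed curve composed of four such consecutive arcs, one in each region (so it closes up after one clockwise turn). Assume the following. (A1) $U\subset\mathbb R^n$ is open, and $\mathbf H^k=(H^k_1,\dots,H^k_{n-1})^T:U\to\mathbb R^{n-1}$ $(k=1,2,3,4)$ are $C^\infty$ such that on $U^k=U\cap R^k$ one has $D\mathbf H^k f^k=0$ and the gradients $DH^k_1,\dots,DH^k_{n-1}$ are linearly independent. (A2) $G\subset\mathbb R^{n-1}$ is open and for every $h\in G$ there are points $A(h)\in\Sigma_A$, $B(h)\in\Sigma_B$, $C(h)\in\Sigma_C$, $E(h)\in\Sigma_E$ in $U$ such that $(S_0)$ has arcs $\widehat{AB},\widehat{BC},\widehat{CE},\widehat{EA}$ in the regions $1,2,3,4$ between these points, and the curves $$L^1_h=\{x\in U^1:\mathbf H^1(x)=h\},\quad L^2_h=\{x\in U^2:\mathbf H^2(x)=\mathbf H^2(B(h))\},$$ $$L^3_h=\{x\in U^3:\mathbf H^3(x)=\mathbf H^3(C(h))\},\quad L^4_h=\{x\in U^4:\mathbf H^4(x)=\mathbf H^4(E(h))\}$$ contain no critical points of $(S_0)$ and are exactly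 the parts of these arcs in $R^1,R^2,R^3,R^4$ (the whole arc $\widehat{AB}$, and the other arcs without their end points). Let $L_h=\widehat{AB}\cup\widehat{BC}\cup\widehat{CE}\cup\widehat{EA}$, a periodic orbit of $(S_0)$. (A3) Write $\overline\Phi$ (resp. $\underline\Phi$) for a matrix $\Phi$ with its first (resp. second) column removed. For every $h\in G$ the $(n-1)\times(n-1)$ matrices $\overline{D\mathbf H^4(A)},\overline{D\mathbf H^1(A)}$, $\underline{D\mathbf H^1(B)},\underline{D\mathbf H^2(B)}$, $\overline{D\mathbf H^2(C)},\overline{D\mathbf H^3(C)}$, $\underline{D\mathbf H^3(E)},\underline{D\mathbf H^4(E)}$ (with $A=A(h)$, etc.) are invertible. Then for every $h\in G$ and all sufficiently small $|\varepsilon|$ there is exactly one point $A_\varepsilon(h)$ at which the orbit of $(S_\varepsilon)$ starting at $A(h)$ returns to $\Sigma_A$ after running through one arc in each of the regions $1,2,3,4$; the map $\varepsilon\mapsto \mathbf H^1(A_\varepsilon(h))-\mathbf H^1(A(h))=:\varepsilon F(h,\varepsilon)$ is differentiable at $\varepsilon=0$; and the first order Melnikov vector function $M(h)=F(h,0)$,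 i.e. its derivative at $\varepsilon=0$, is $$\begin{aligned}M(h)=&\int_{\widehat{AB}}D\mathbf H^1g^1\,dt+\overline{D\mathbf H^1(A)}\big[\overline{D\mathbf H^4(A)}\big]^{-1}\underline{D\mathbf H^4(E)}\big[\underline{D\mathbf H^3(E)}\big]^{-1}\overline{D\mathbf H^3(C)}\big[\overline{D\mathbf H^2(C)}\big]^{-1}\int_{\widehat{BC}}D\mathbf H^2g^2\,dt\\&+\overline{D\mathbf H^1(A)}\big[\overline{D\mathbf H^4(A)}\big]^{-1}\underline{D\mathbf H^4(E)}\big[\underline{D\mathbf H^3(E)}\big]^{-1}\int_{\widehat{CE}}D\mathbf H^3g^3\,dt+\overline{D\mathbf H^1(A)}\big[\overline{D\mathbf H^4(A)}\big]^{-1}\int_{\widehat{EA}}D\mathbf H^4g^4\,dt .\end{aligned}$$ Moreover, if $h_0\in G$, $M(h_0)=0$ and $\det DM(h_0)\ne0$, then there is $\delta_0>0$ such that for every $0<\delta\le\delta_0$ there is $\varepsilon_0>0$ such that for all $\varepsilon$ with $0<|\varepsilon|<\varepsilon_0$ the system $(S_\varepsilon)$ has exactly one periodic orbit contained in the $\delta$-neighbourhood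 of $L_{h_0}$. -/

import Mathlib

open Set Filter Topology
open scoped ContDiff

noncomputable section

namespace PiecewiseMelnikov

/-- The phase space `ℝⁿ`, `n = m + 2 ≥ 2`.  The coordinates `x₁, x₂` of the text are the
coordinates with index `0` and `1` here. -/
abbrev Phase (m : ℕ) : Type := Fin (m + 2) → ℝ

/-- The space `ℝⁿ⁻¹` of values of the first integrals. -/
abbrev Level (m : ℕ) : Type := Fin (m + 1) → ℝ

/-- The four open quadrant regions, numbered clockwise from `x₁ > 0, x₂ > 0`. -/
def openQuadrant {m : ℕ} : Fin 4 → Set (Phase m) :=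
  ![{x | 0 < x 0 ∧ 0 < x 1}, {x | 0 < x 0 ∧ x 1 < 0},
    {x | x 0 < 0 ∧ x 1 < 0}, {x | x 0 < 0 ∧ 0 < x 1}]

/-- The regions on which the four subsystems are given: the first one is closed, the others open. -/
def region {m : ℕ} : Fin 4 → Set (Phase m) :=
  ![{x | 0 ≤ x 0 ∧ 0 ≤ x 1}, {x | 0 < x 0 ∧ x 1 < 0},
    {x | x 0 < 0 ∧ x 1 < 0}, {x | x 0 < 0 ∧ 0 < x 1}]

/-- The four pieces of the switching planes, in the order in which a clockwise orbit meets them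
(at `A`, `B`, `C`, `E`).  Piece `k` separates quadrant `k - 1` from quadrant `k` (mod 4). -/
def switching {m : ℕ} : Fin 4 → Set (Phase m) :=
  ![{x | x 0 = 0 ∧ 0 < x 1}, {x | x 1 = 0 ∧ 0 < x 0},
    {x | x 0 = 0 ∧ x 1 < 0}, {x | x 1 = 0 ∧ x 0 < 0}]

/-- `γ : [0, T] → ℝⁿ` is an orbital arc of `ẋ = v x` through quadrant `k`, from `p` on the `k`-th
to `q` on the `(k+1)`-st piece of the switching planes; in between it stays in the open quadrant,
so that `q` is the first intersection with the switching planes. -/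
structure IsArc {m : ℕ} (k : Fin 4) (v : Phase m → Phase m) (γ : ℝ → Phase m) (T : ℝ)
    (p q : Phase m) : Prop where
  pos : 0 < T
  start_mem : p ∈ switching k
  end_mem : q ∈ switching (k + 1)
  start_eq : γ 0 = p
  end_eq : γ T = q
  ode : ∀ t ∈ Icc 0 T, HasDerivWithinAt γ (v (γ t)) (Icc 0 T) t
  interior : ∀ t ∈ Ioo 0 T, γ t ∈ openQuadrant k

/-- The four vector fields `f^k + ε g^k`. -/
def perturbed {m : ℕ} (f g : Fin 4 → Phase m → Phase m) (ε : ℝ) : Fin 4 → Phase m → Phase m :=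
  fun k x => f k x + ε • g k x

/-- `Γ` is a (crossing) periodic orbit of the piecewise system with fields `v k` on quadrant `k`,
consisting of one arc in each quadrant. -/
def IsPeriodicOrbit {m : ℕ} (v : Fin 4 → Phase m → Phase m) (Γ : Set (Phase m)) : Prop :=
  ∃ (p : Fin 4 → Phase m) (T : Fin 4 → ℝ) (γ : Fin 4 → ℝ → Phase m),
    (∀ k, IsArc k (v k) (γ k) (T k) (p k) (p (k + 1))) ∧ Γ = ⋃ k, γ k '' Icc 0 (T k)

/-- `q` is the first return of `p` to `x₁ = 0, x₂ > 0`, after one turn through the four regions. -/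
def IsReturn {m : ℕ} (v : Fin 4 → Phase m → Phase m) (p q : Phase m) : Prop :=
  ∃ b c e : Phase m,
    (∃ γ T, IsArc 0 (v 0) γ T p b) ∧ (∃ γ T, IsArc 1 (v 1) γ T b c) ∧
    (∃ γ T, IsArc 2 (v 2) γ T c e) ∧ (∃ γ T, IsArc 3 (v 3) γ T e q)

/-- The Poincaré map. -/
def returnPoint {m : ℕ} (v : Fin 4 → Phase m → Phase m) (p : Phase m) : Phase m :=
  Classical.epsilon (IsReturn v p)

/-- `H¹(A_ε(h)) - H¹(A(h))`. -/
def displacement {m : ℕ} (f g : Fin 4 → Phase m → Phase m) (H : Fin 4 → Phase m → Level m)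
    (A : Level m → Phase m) (h : Level m) (ε : ℝ) : Level m :=
  H 0 (returnPoint (perturbed f g ε) (A h)) - H 0 (A h)

/-- `F(h, ε)`, with `H¹(A_ε(h)) - H¹(A(h)) = ε F(h, ε)`; at `ε = 0` it is the derivative of the
left hand side. -/
def bifurcationFunction {m : ℕ} (f g : Fin 4 → Phase m → Phase m)
    (H : Fin 4 → Phase m → Level m) (A : Level m → Phase m) (h : Level m) (ε : ℝ) : Level m :=
  dslope (displacement f g H A h) 0 ε

/-- The first order Melnikov vector function `M(h) = F(h, 0)`. -/
def melnikov {m : ℕ} (f g : Fin 4 → Phase m → Phase m) (H : Fin 4 → Phase m → Level m)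
    (A : Level m → Phase m) (h : Level m) : Level m :=
  bifurcationFunction f g H A h 0

/-- The `(n-1) × n` Jacobian matrix of `K` at `x`. -/
def jacobian {m : ℕ} (K : Phase m → Level m) (x : Phase m) :
    Matrix (Fin (m + 1)) (Fin (m + 2)) ℝ :=
  LinearMap.toMatrix' (fderiv ℝ K x : Phase m →ₗ[ℝ] Level m)

/-- The overlined Jacobian: the first column is removed. -/
def jacOver {m : ℕ} (K : Phase m → Level m) (x : Phase m) :
    Matrix (Fin (m + 1)) (Fin (m + 1)) ℝ :=
  (jacobian K x).submatrix id (Fin.succAbove 0)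

/-- The underlined Jacobian: the second column is removed. -/
def jacUnder {m : ℕ} (K : Phase m → Level m) (x : Phase m) :
    Matrix (Fin (m + 1)) (Fin (m + 1)) ℝ :=
  (jacobian K x).submatrix id (Fin.succAbove 1)

/-- Each unperturbed subsystem has `n - 1` smooth first integrals, with linearly independent
gradients on its region. -/
structure AssumptionA1 {m : ℕ} (f : Fin 4 → Phase m → Phase m) (U : Set (Phase m))
    (H : Fin 4 → Phase m → Level m) : Prop where
  isOpen : IsOpen U
  smooth : ∀ k, ContDiffOn ℝ ∞ (H k) U
  first_integral : ∀ k, ∀ x ∈ U ∩ region k, fderiv ℝ (H k) x (f k x) = 0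
  independent : ∀ k, ∀ x ∈ U ∩ region k,
    LinearIndependent ℝ (fun i : Fin (m + 1) => fderiv ℝ (fun y => H k y i) x)

/-- The level set `L_h^k`: on `U¹` the level `H¹ = h`, on the other regions the level of `H^k`
through the end point of the preceding arc. -/
def levelCurve {m : ℕ} (U : Set (Phase m)) (H : Fin 4 → Phase m → Level m)
    (B C E : Level m → Phase m) (h : Level m) : Fin 4 → Set (Phase m) :=
  ![{x ∈ U ∩ region 0 | H 0 x = h}, {x ∈ U ∩ region 1 | H 1 x = H 1 (B h)},
    {x ∈ U ∩ region 2 | H 2 x = H 2 (C h)}, {x ∈ U ∩ region 3 | H 3 x = H 3 (E h)}]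

/-- The family of clockwise periodic orbits: for `h ∈ G` the level curves `L_h^k` contain no
critical points and are orbital arcs from `A` to `B`, `B` to `C`, `C` to `E` and `E` to `A`;
`γ k h : [0, T k h] → ℝⁿ` is the time parametrization of the `k`-th arc. -/
structure AssumptionA2 {m : ℕ} (f : Fin 4 → Phase m → Phase m) (U : Set (Phase m))
    (H : Fin 4 → Phase m → Level m) (G : Set (Level m)) (A B C E : Level m → Phase m)
    (T : Fin 4 → Level m → ℝ) (γ : Fin 4 → Level m → ℝ → Phase m) : Prop where
  isOpen : IsOpen G
  mem : ∀ h ∈ G, A h ∈ U ∧ B h ∈ U ∧ C h ∈ U ∧ E h ∈ U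
  noncritical : ∀ h ∈ G, ∀ k, ∀ x ∈ levelCurve U H B C E h k, f k x ≠ 0
  arc_AB : ∀ h ∈ G, IsArc 0 (f 0) (γ 0 h) (T 0 h) (A h) (B h)
  arc_BC : ∀ h ∈ G, IsArc 1 (f 1) (γ 1 h) (T 1 h) (B h) (C h)
  arc_CE : ∀ h ∈ G, IsArc 2 (f 2) (γ 2 h) (T 2 h) (C h) (E h)
  arc_EA : ∀ h ∈ G, IsArc 3 (f 3) (γ 3 h) (T 3 h) (E h) (A h)
  /-- Only the first region contains the end points of its arc. -/
  level_eq : ∀ h ∈ G, ∀ k,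
    levelCurve U H B C E h k = (γ k h '' Icc 0 (T k h)) ∩ region k

/-- The arcs are transversal to the switching planes at their end points. -/
structure AssumptionA3 {m : ℕ} (H : Fin 4 → Phase m → Level m) (G : Set (Level m))
    (A B C E : Level m → Phase m) : Prop where
  at_A : ∀ h ∈ G, (jacOver (H 3) (A h)).det ≠ 0 ∧ (jacOver (H 0) (A h)).det ≠ 0
  at_B : ∀ h ∈ G, (jacUnder (H 0) (B h)).det ≠ 0 ∧ (jacUnder (H 1) (B h)).det ≠ 0
  at_C : ∀ h ∈ G, (jacOver (H 1) (C h)).det ≠ 0 ∧ (jacOver (H 2) (C h)).det ≠ 0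
  at_E : ∀ h ∈ G, (jacUnder (H 2) (E h)).det ≠ 0 ∧ (jacUnder (H 3) (E h)).det ≠ 0

/-- The integral of `DK · w` with respect to time along `γ : [0, T] → ℝⁿ`. -/
def arcIntegral {m : ℕ} (K : Phase m → Level m) (w : Phase m → Phase m) (γ : ℝ → Phase m)
    (T : ℝ) : Level m :=
  ∫ t in (0 : ℝ)..T, fderiv ℝ K (γ t) (w (γ t))

/-- The explicit expression for the first order Melnikov function. -/
def melnikovFormula {m : ℕ} (g : Fin 4 → Phase m → Phase m) (H : Fin 4 → Phase m → Level m)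
    (A C E : Level m → Phase m) (T : Fin 4 → Level m → ℝ) (γ : Fin 4 → Level m → ℝ → Phase m)
    (h : Level m) : Level m :=
  arcIntegral (H 0) (g 0) (γ 0 h) (T 0 h)
  + (jacOver (H 0) (A h) * (jacOver (H 3) (A h))⁻¹
      * jacUnder (H 3) (E h) * (jacUnder (H 2) (E h))⁻¹
      * jacOver (H 2) (C h) * (jacOver (H 1) (C h))⁻¹).mulVec
        (arcIntegral (H 1) (g 1) (γ 1 h) (T 1 h))
  + (jacOver (H 0) (A h) * (jacOver (H 3) (A h))⁻¹
      * jacUnder (H 3) (E h) * (jacUnder (H 2) (E h))⁻¹).mulVec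
        (arcIntegral (H 2) (g 2) (γ 2 h) (T 2 h))
  + (jacOver (H 0) (A h) * (jacOver (H 3) (A h))⁻¹).mulVec
        (arcIntegral (H 3) (g 3) (γ 3 h) (T 3 h))

/-- The unperturbed periodic orbit `L_h`. -/
def orbit {m : ℕ} (T : Fin 4 → Level m → ℝ) (γ : Fin 4 → Level m → ℝ → Phase m) (h : Level m) :
    Set (Phase m) :=
  ⋃ k, γ k h '' Icc 0 (T k h)

end PiecewiseMelnikov

end

/-! In the coordinate h the Poincaré map becomes a map R(·, ε) of ℝⁿ⁻¹: start at A(h), run through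
the four arcs, evaluate H¹ at the return point. Inside U a level h ∈ G of H¹ determines the point of
Σ_A, so the periodic orbits near L_{h₀} correspond to fixed points of R(·, ε). All orbits of the
unperturbed family close, so R(h, 0) = h, and M is ∂R/∂ε at ε = 0.

Smoothness of R comes from two uses of the implicit function theorem. Solutions rescaled to [0, 1]
are zeros of a smooth map on C([0, 1], E), whose derivative in the curve is the identity minus a
Volterra operator, hence invertible (`exists_contDiffAt_solution`). By (A3) the derivative of each
first integral is injective on the switching plane while it kills the nonzero velocity, so arcs are
transversal at both ends (`pos_velocity_of_first_integral`, `neg_velocity_of_first_integral`); the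
exit time is then a smooth function of the initial point and ε, and nearby orbits remain in the
quadrant (`exists_isTransit`).

For the formula, H^k grows along a perturbed arc at the rate ε DH^k g^k. Thus a transit map from p
to q sends a first order variation x' to y' with DH^k(q) y' = DH^k(p) x' + ∫ DH^k g^k dt, and the
invertible minors of (A3) solve for y'. The integral I₀ over the first arc need not be carried
around the circuit: along the initial points A(h - ε I₀) the point on Σ_B is stationary to first
order, so only the other three integrals are transported, and R(h, 0) = h gives back the summand I₀
(`exists_hasDerivAt_returnMap`, `exists_local_return`).

Finally (R(x, ε) - x)/ε differs from the invertible linear map DM(h₀) by a function of small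
Lipschitz constant, on a ball independent of ε (`approximatesLinearOn_displacement`). A quantitative
inverse function argument gives one zero near h₀ (`fixedPoints_of_simple_zero`), and
`exists_thickening_orbit` makes this account for every periodic orbit close to L_{h₀}. -/

noncomputable section

namespace PiecewiseMelnikov

universe u

/-! ### Calculus of superposition operators on spaces of continuous functions. -/

section PointwiseApply

variable {K : Type*} [TopologicalSpace K] [CompactSpace K]
variable {E F : Type*} [NormedAddCommGroup E] [NormedSpace ℝ E]
  [NormedAddCommGroup F] [NormedSpace ℝ F]

/-- Pointwise application of a continuous family of operators to a continuous function. -/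
def pointwiseApply : C(K, E →L[ℝ] F) →L[ℝ] C(K, E) →L[ℝ] C(K, F) :=
  LinearMap.mkContinuous₂
    (LinearMap.mk₂ ℝ (fun (a : C(K, E →L[ℝ] F)) (η : C(K, E)) =>
        (⟨fun t => a t (η t), by fun_prop⟩ : C(K, F)))
      (fun a b η => by ext; simp) (fun c a η => by ext; simp)
      (fun a η θ => by ext; simp) (fun c a η => by ext; simp))
    1 (fun a η => by
      rw [ContinuousMap.norm_le _ (by positivity)]
      intro t
      calc ‖a t (η t)‖ ≤ ‖a t‖ * ‖η t‖ := (a t).le_opNorm _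
        _ ≤ 1 * ‖a‖ * ‖η‖ := by
          rw [one_mul]
          gcongr
          · exact a.norm_coe_le_norm t
          · exact η.norm_coe_le_norm t)

@[simp]
theorem pointwiseApply_apply (a : C(K, E →L[ℝ] F)) (η : C(K, E)) (t : K) :
    pointwiseApply a η t = a t (η t) := rfl

end PointwiseApply

section Superposition

variable {K E F : Type*} [TopologicalSpace K] [TopologicalSpace E] [TopologicalSpace F]

/-- The superposition operator `γ ↦ v ∘ γ`. -/
def superposition (v : C(E, F)) (γ : C(K, E)) : C(K, F) := v.comp γ

@[simp]
theorem superposition_apply (v : C(E, F)) (γ : C(K, E)) (t : K) :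
    superposition v γ t = v (γ t) := rfl

theorem continuous_superposition (v : C(E, F)) :
    Continuous (superposition v : C(K, E) → C(K, F)) :=
  v.continuous_postcomp

end Superposition

/-- The mean value inequality on the segment from γ(t) to γ'(t) bounds the remainder at t. The bound
is uniform in t because superposition with v' is continuous in the sup norm. -/
theorem hasFDerivAt_superposition {K : Type*} [TopologicalSpace K] [CompactSpace K]
    {E F : Type*} [NormedAddCommGroup E] [NormedSpace ℝ E]
    [NormedAddCommGroup F] [NormedSpace ℝ F] (v : C(E, F)) (v' : C(E, E →L[ℝ] F))
    (hv : ∀ x, HasFDerivAt v (v' x) x) (γ : C(K, E)) :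
    HasFDerivAt (superposition v) (pointwiseApply (superposition v' γ)) γ := by
  rw [hasFDerivAt_iff_isLittleO, Asymptotics.isLittleO_iff]
  intro c hc
  have hcont : ContinuousAt (superposition v' : C(K, E) → C(K, E →L[ℝ] F)) γ :=
    (continuous_superposition v').continuousAt
  obtain ⟨δ, hδ, h⟩ := Metric.continuousAt_iff (α := C(K, E)) (β := C(K, E →L[ℝ] F)) |>.1 hcont c hc
  filter_upwards [Metric.ball_mem_nhds γ hδ] with γ' hγ'
  rw [ContinuousMap.norm_le _ (by positivity)]
  intro t
  have key : ∀ y ∈ segment ℝ (γ t) (γ' t), ‖v' y - v' (γ t)‖ ≤ c := by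
    intro y hy
    rw [segment_eq_image'] at hy
    obtain ⟨s, hs, rfl⟩ := hy
    -- A point of the segment at t is the value at t of a curve on the segment from γ to γ', which
    -- is still δ-close to γ.
    have h1 : dist (γ + s • (γ' - γ)) γ < δ := by
      rw [dist_eq_norm, add_sub_cancel_left, norm_smul, Real.norm_of_nonneg hs.1]
      calc s * ‖γ' - γ‖ ≤ 1 * ‖γ' - γ‖ := by gcongr; exact hs.2
        _ < δ := by rw [one_mul, ← dist_eq_norm]; exact hγ'
    have h2 := (ContinuousMap.dist_apply_le_dist t).trans (h h1).le
    rw [dist_eq_norm] at h2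
    simpa using h2
  have h3 := (convex_segment (γ t) (γ' t)).norm_image_sub_le_of_norm_hasFDerivWithin_le'
    (fun y _ => (hv y).hasFDerivWithinAt) key (left_mem_segment ℝ _ _) (right_mem_segment ℝ _ _)
  calc _ = ‖v (γ' t) - v (γ t) - v' (γ t) (γ' t - γ t)‖ := by simp
    _ ≤ c * ‖γ' t - γ t‖ := h3
    _ ≤ c * ‖γ' - γ‖ := by
      gcongr
      exact (γ' - γ).norm_coe_le_norm t

/-- The derivative is a continuous linear map applied to superposition with v', so each order
reduces to the previous one for v'. Quantifying over F inside the induction admits E →L[ℝ] F as the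
new target; the common universe keeps this target in the same universe. -/
theorem contDiff_superposition_nat {K : Type*} [TopologicalSpace K] [CompactSpace K]
    {E : Type u} [NormedAddCommGroup E] [NormedSpace ℝ E] (n : ℕ) :
    ∀ {F : Type u} [NormedAddCommGroup F] [NormedSpace ℝ F] (v : C(E, F)),
      ContDiff ℝ n v → ContDiff ℝ n (superposition v : C(K, E) → C(K, F)) := by
  induction n with
  | zero =>
    intro F _ _ v _
    simpa using continuous_superposition v
  | succ n ih =>
    intro F _ _ v hv
    rw [Nat.cast_add, Nat.cast_one] at hv ⊢
    rw [contDiff_succ_iff_hasFDerivAt]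
    have hv' := (contDiff_succ_iff_fderiv (𝕜 := ℝ)).1 hv
    let v' : C(E, E →L[ℝ] F) := ⟨fderiv ℝ v, hv'.2.2.continuous⟩
    refine ⟨fun γ => pointwiseApply (superposition v' γ), ?_, fun γ =>
      hasFDerivAt_superposition v v' (fun x => hv'.1.differentiableAt.hasFDerivAt) γ⟩
    exact pointwiseApply.contDiff.comp (ih v' hv'.2.2)

theorem contDiff_superposition {K : Type*} [TopologicalSpace K] [CompactSpace K]
    {E F : Type u} [NormedAddCommGroup E] [NormedSpace ℝ E]
    [NormedAddCommGroup F] [NormedSpace ℝ F] (v : C(E, F)) (hv : ContDiff ℝ ∞ v) :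
    ContDiff ℝ ∞ (superposition v : C(K, E) → C(K, F)) :=
  contDiff_infty.2 fun n => contDiff_superposition_nat n v (contDiff_infty.1 hv n)

/-- The unit time interval. -/
abbrev UnitTime : Type := Icc (0 : ℝ) 1

/-! ### Volterra operators and their quasi-nilpotence. -/

section Primitive

variable {E : Type*} [NormedAddCommGroup E] [NormedSpace ℝ E]

theorem continuous_extend {E : Type*} [TopologicalSpace E] (η : C(UnitTime, E)) :
    Continuous fun s : ℝ => η (projIcc 0 1 zero_le_one s) :=
  η.continuous.comp continuous_projIcc

theorem continuous_integral_extend (η : C(UnitTime, E)) :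
    Continuous fun t : ℝ => ∫ s in (0 : ℝ)..t, η (projIcc 0 1 zero_le_one s) :=
  intervalIntegral.continuous_primitive (fun a b => (continuous_extend η).intervalIntegrable a b) 0

/-- The primitive vanishing at `0`, as an operator on continuous functions on `[0, 1]`. -/
def primitive : C(UnitTime, E) →L[ℝ] C(UnitTime, E) :=
  LinearMap.mkContinuous
    { toFun := fun η => ⟨fun t => ∫ s in (0 : ℝ)..t, η (projIcc 0 1 zero_le_one s),
        (continuous_integral_extend η).comp continuous_subtype_val⟩
      map_add' := fun η θ => by
        ext t
        exact intervalIntegral.integral_add ((continuous_extend η).intervalIntegrable _ _)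
          ((continuous_extend θ).intervalIntegrable _ _)
      map_smul' := fun c η => by
        ext t
        exact intervalIntegral.integral_smul c _ }
    1 (fun η => by
      rw [ContinuousMap.norm_le _ (by positivity)]
      intro t
      calc ‖∫ s in (0 : ℝ)..t, η (projIcc 0 1 zero_le_one s)‖ ≤ ‖η‖ * |(t : ℝ) - 0| :=
            intervalIntegral.norm_integral_le_of_norm_le_const
              fun s _ => η.norm_coe_le_norm _
        _ ≤ 1 * ‖η‖ := by
          rw [sub_zero, abs_of_nonneg t.2.1, mul_comm]
          gcongr
          exact t.2.2)

/-- The Volterra operator with coefficient `a`. -/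
def volterra (a : C(UnitTime, E →L[ℝ] E)) : C(UnitTime, E) →L[ℝ] C(UnitTime, E) :=
  primitive ∘L pointwiseApply a

/-- Keeping the power of t, rather than its bound 1, makes each integration contribute a factor 1/(n
+ 1), hence the factorial. -/
theorem norm_volterra_pow_apply_le (a : C(UnitTime, E →L[ℝ] E)) (n : ℕ) (η : C(UnitTime, E))
    (t : UnitTime) :
    ‖(volterra a ^ n) η t‖ ≤ (‖a‖ * t) ^ n / n.factorial * ‖η‖ := by
  induction n generalizing t with
  | zero => simpa using η.norm_coe_le_norm t
  | succ n ih =>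
    have ht : (0 : ℝ) ≤ t := t.2.1
    rw [pow_succ']
    change ‖∫ s in (0 : ℝ)..t, a (projIcc 0 1 zero_le_one s)
      ((volterra a ^ n) η (projIcc 0 1 zero_le_one s))‖ ≤ _
    have hb : ∀ s ∈ Ioc (0 : ℝ) t, ‖a (projIcc 0 1 zero_le_one s)
      ((volterra a ^ n) η (projIcc 0 1 zero_le_one s))‖ ≤
        ‖a‖ ^ (n + 1) / n.factorial * ‖η‖ * s ^ n := by
      intro s hs
      have hs' : s ∈ Icc (0 : ℝ) 1 := ⟨hs.1.le, hs.2.trans t.2.2⟩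
      have h1 := ih (projIcc 0 1 zero_le_one s)
      rw [projIcc_of_mem zero_le_one hs'] at h1 ⊢
      calc _ ≤ ‖a ⟨s, hs'⟩‖ * ‖(volterra a ^ n) η ⟨s, hs'⟩‖ := ContinuousLinearMap.le_opNorm _ _
        _ ≤ ‖a‖ * ((‖a‖ * s) ^ n / n.factorial * ‖η‖) := by
          gcongr
          exact a.norm_coe_le_norm _
        _ = _ := by rw [mul_pow]; ring
    refine (intervalIntegral.norm_integral_le_of_norm_le ht (MeasureTheory.ae_of_all _ hb)
      ((continuous_const.mul (continuous_id.pow n)).intervalIntegrable _ _)).trans (le_of_eq ?_)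
    rw [intervalIntegral.integral_const_mul, integral_pow, Nat.factorial_succ]
    push_cast
    field_simp
    simp
    ring

theorem exists_norm_volterra_pow_lt_one (a : C(UnitTime, E →L[ℝ] E)) :
    ∃ n, ‖volterra a ^ n‖ < 1 := by
  have h := FloorSemiring.tendsto_pow_div_factorial_atTop ‖a‖
  obtain ⟨n, hn⟩ := (h.eventually_lt_const zero_lt_one).exists
  refine ⟨n, lt_of_le_of_lt ?_ hn⟩
  refine ContinuousLinearMap.opNorm_le_bound _ (by positivity) fun η => ?_
  rw [ContinuousMap.norm_le _ (by positivity)]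
  intro t
  refine (norm_volterra_pow_apply_le a n η t).trans ?_
  gcongr
  · exact mul_nonneg (norm_nonneg a) t.2.1
  · exact mul_le_of_le_one_right (norm_nonneg a) t.2.2

/-- The operator itself may be large, but some power has norm below 1. Then 1 - Vⁿ is a unit, and 1
- V is one of its commuting factors in the geometric sum identity. -/
theorem isUnit_one_sub_volterra [CompleteSpace E] (a : C(UnitTime, E →L[ℝ] E)) :
    IsUnit (1 - volterra a) := by
  obtain ⟨n, hn⟩ := exists_norm_volterra_pow_lt_one a
  have h1 : IsUnit (1 - volterra a ^ n) :=
    isUnit_one_sub_of_norm_lt_one (R := C(UnitTime, E) →L[ℝ] C(UnitTime, E)) hn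
  have h2 : (1 - volterra a) * (∑ i ∈ Finset.range n, volterra a ^ i) = 1 - volterra a ^ n :=
    mul_neg_geom_sum _ n
  have hc : Commute (1 - volterra a) (∑ i ∈ Finset.range n, volterra a ^ i) :=
    Commute.sum_right _ _ _ fun i _ =>
      (Commute.one_left _).sub_left ((Commute.refl _).pow_right i)
  rw [← h2] at h1
  exact (hc.isUnit_mul_iff.1 h1).1

theorem isInvertible_id_sub_volterra [CompleteSpace E] (a : C(UnitTime, E →L[ℝ] E)) :
    (ContinuousLinearMap.id ℝ _ - volterra a).IsInvertible := by
  obtain ⟨w, hw⟩ := isUnit_one_sub_volterra a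
  exact ⟨ContinuousLinearEquiv.unitsEquiv ℝ _ w, by
    ext1 x
    rw [← ContinuousLinearMap.one_def, ← hw]
    rfl⟩

end Primitive

/-! ### Smooth dependence and uniqueness for ordinary differential equations. -/

section Flow

variable {E : Type u} [NormedAddCommGroup E] [NormedSpace ℝ E] [CompleteSpace E]

/-- Smooth dependence of solutions on the initial value, near a solution on `[0, 1]`. -/
theorem exists_contDiffAt_solution {v : E → E} (hv : ContDiff ℝ ∞ v) (γ₀ : C(UnitTime, E)) (x₀ : E)
    (h₀ : ∀ t : UnitTime, γ₀ t = x₀ + ∫ s in (0 : ℝ)..t, v (γ₀ (projIcc 0 1 zero_le_one s))) :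
    ∃ Ψ : E → C(UnitTime, E), ContDiffAt ℝ ∞ Ψ x₀ ∧ Ψ x₀ = γ₀ ∧
      ∀ᶠ x in 𝓝 x₀, ∀ t : UnitTime,
        Ψ x t = x + ∫ s in (0 : ℝ)..t, v (Ψ x (projIcc 0 1 zero_le_one s)) := by
  let V : C(E, E) := ⟨v, hv.continuous⟩
  let V' : C(E, E →L[ℝ] E) := ⟨fderiv ℝ v, hv.continuous_fderiv (by simp)⟩
  let c : E →L[ℝ] C(UnitTime, E) := ContinuousLinearMap.const ℝ UnitTime
  -- The zeros of Φ are the pairs (initial value, solution of the integral equation).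
  let Φ : E × C(UnitTime, E) → C(UnitTime, E) :=
    fun z => z.2 - c z.1 - primitive (superposition V z.2)
  have hΦ : ContDiff ℝ ∞ Φ := by
    have := (contDiff_superposition (K := UnitTime) V hv).comp
      (contDiff_snd (𝕜 := ℝ) (E := E) (F := C(UnitTime, E)))
    exact (contDiff_snd.sub (c.contDiff.comp contDiff_fst)).sub
      ((primitive (E := E)).contDiff.comp this)
  have hzero : Φ (x₀, γ₀) = 0 := by
    ext t
    change γ₀ t - x₀ - ∫ s in (0 : ℝ)..t, v (γ₀ (projIcc 0 1 zero_le_one s)) = 0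
    rw [h₀ t]; abel
  have hd : HasFDerivAt Φ (ContinuousLinearMap.snd ℝ E C(UnitTime, E)
      - c ∘L ContinuousLinearMap.fst ℝ E C(UnitTime, E)
      - primitive ∘L (pointwiseApply (superposition V' γ₀)) ∘L
        ContinuousLinearMap.snd ℝ E C(UnitTime, E)) (x₀, γ₀) := by
    have h1 := hasFDerivAt_superposition V V'
      (fun x => (hv.differentiable (by simp) x).hasFDerivAt) γ₀
    have h2 : HasFDerivAt (fun z : E × C(UnitTime, E) => superposition V z.2) _ (x₀, γ₀) :=
      HasFDerivAt.comp (x₀, γ₀) h1 hasFDerivAt_snd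
    exact (hasFDerivAt_snd.sub (c.hasFDerivAt.comp _ hasFDerivAt_fst)).sub
      ((primitive (E := E)).hasFDerivAt.comp _ h2)
  have hinv : (fderiv ℝ Φ (x₀, γ₀) ∘L .inr ℝ E C(UnitTime, E)).IsInvertible := by
    rw [hd.fderiv]
    obtain ⟨e, he⟩ := isInvertible_id_sub_volterra (superposition V' γ₀)
    refine ⟨e, ?_⟩
    rw [he]
    ext η t
    simp [volterra]
  have hΦa := hΦ.contDiffAt (x := (x₀, γ₀))
  refine ⟨hΦa.implicitFunction (by simp) hinv, hΦa.contDiffAt_implicitFunction (by simp) hinv,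
    hΦa.implicitFunction_apply_self (by simp) hinv, ?_⟩
  filter_upwards [hΦa.eventually_apply_implicitFunction (by simp) hinv] with x hx t
  rw [hzero] at hx
  have := congrArg (fun η : C(UnitTime, E) => η t) hx
  rw [← sub_eq_zero, ← sub_sub]
  exact this

end Flow

/-- Two solutions of an autonomous `C^1` equation with the same initial value agree. -/
theorem solution_eqOn {E : Type*} [NormedAddCommGroup E] [NormedSpace ℝ E] [ProperSpace E]
    {v : E → E} (hv : ContDiff ℝ 1 v) {T : ℝ} {α β : ℝ → E}
    (hα : ∀ t ∈ Icc 0 T, HasDerivWithinAt α (v (α t)) (Icc 0 T) t)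
    (hβ : ∀ t ∈ Icc 0 T, HasDerivWithinAt β (v (β t)) (Icc 0 T) t) (h0 : α 0 = β 0) :
    EqOn α β (Icc 0 T) := by
  have cα : ContinuousOn α (Icc 0 T) := fun t ht => (hα t ht).continuousWithinAt
  have cβ : ContinuousOn β (Icc 0 T) := fun t ht => (hβ t ht).continuousWithinAt
  -- Both curves lie in one closed ball, which is convex and compact, so a C¹ field is Lipschitz
  -- there; no global Lipschitz bound is needed.
  have hK := (isCompact_Icc.image_of_continuousOn cα).union (isCompact_Icc.image_of_continuousOn cβ)
  obtain ⟨R, hR⟩ := hK.isBounded.subset_closedBall 0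
  obtain ⟨K, hLip⟩ := hv.contDiffOn.exists_lipschitzOnWith one_ne_zero
    (convex_closedBall (0 : E) R) (isCompact_closedBall _ _)
  refine ODE_solution_unique_of_mem_Icc_right (v := fun _ => v)
    (s := fun _ => Metric.closedBall 0 R)
    (fun _ _ => hLip) cα ?_ ?_ cβ ?_ ?_ h0
  · exact fun t ht => ((hα t (Ico_subset_Icc_self ht)).mono_of_mem_nhdsWithin
      (Icc_mem_nhdsGE_of_mem ht))
  · exact fun t ht => hR (Or.inl (mem_image_of_mem _ (Ico_subset_Icc_self ht)))
  · exact fun t ht => ((hβ t (Ico_subset_Icc_self ht)).mono_of_mem_nhdsWithin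
      (Icc_mem_nhdsGE_of_mem ht))
  · exact fun t ht => hR (Or.inr (mem_image_of_mem _ (Ico_subset_Icc_self ht)))

theorem hasDerivWithinAt_comp_mul {E : Type*} [NormedAddCommGroup E] [NormedSpace ℝ E]
    {α : ℝ → E} {α' : E} {T τ s : ℝ} {S : Set ℝ}
    (hmap : MapsTo (fun r => τ * r) S (Icc 0 T))
    (h : HasDerivWithinAt α α' (Icc 0 T) (τ * s)) :
    HasDerivWithinAt (fun r => α (τ * r)) (τ • α') S s := by
  have h1 : HasDerivWithinAt (fun r : ℝ => τ * r) τ S s := by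
    simpa using ((hasDerivAt_id s).const_mul τ).hasDerivWithinAt
  exact h.scomp s h1 hmap

section Parameters

variable {E : Type u} [NormedAddCommGroup E] [NormedSpace ℝ E]

/-- The field `τ (f + ε g)` on the phase space extended by the time scale `τ` and the
parameter `ε`. -/
def extendedField (f g : E → E) (z : E × ℝ × ℝ) : E × ℝ × ℝ :=
  (z.2.1 • (f z.1 + z.2.2 • g z.1), 0)

theorem contDiff_extendedField {f g : E → E} (hf : ContDiff ℝ ∞ f) (hg : ContDiff ℝ ∞ g) :
    ContDiff ℝ ∞ (extendedField f g) := by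
  unfold extendedField
  fun_prop

/-- Smooth dependence on the initial value, the time scale and the parameter. -/
theorem exists_contDiffAt_rescaled_solution [CompleteSpace E] {f g : E → E} (hf : ContDiff ℝ ∞ f)
    (hg : ContDiff ℝ ∞ g) {γ : ℝ → E} {T : ℝ} (hT : 0 < T)
    (hode : ∀ t ∈ Icc 0 T, HasDerivWithinAt γ (f (γ t)) (Icc 0 T) t) :
    ∃ Ψ : E × ℝ × ℝ → C(UnitTime, E), ContDiffAt ℝ ∞ Ψ (γ 0, T, 0) ∧
      (∀ s : UnitTime, Ψ (γ 0, T, 0) s = γ (T * s)) ∧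
      ∀ᶠ z in 𝓝 (γ 0, T, (0 : ℝ)), Ψ z 0 = z.1 ∧
        ∀ s ∈ Icc (0 : ℝ) 1, HasDerivWithinAt (fun r => Ψ z (projIcc 0 1 zero_le_one r))
          (z.2.1 • (f (Ψ z (projIcc 0 1 zero_le_one s))
            + z.2.2 • g (Ψ z (projIcc 0 1 zero_le_one s)))) (Icc 0 1) s := by
  have hW := contDiff_extendedField hf hg
  have cγ : ContinuousOn γ (Icc 0 T) := fun t ht => (hode t ht).continuousWithinAt
  have hmap : MapsTo (fun r => T * r) (Icc 0 1) (Icc 0 T) := fun s hs =>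
    ⟨mul_nonneg hT.le hs.1, mul_le_of_le_one_right hT.le hs.2⟩
  let γ₀ : C(UnitTime, E × ℝ × ℝ) := ⟨fun s => (γ (T * s), T, 0), by
    refine Continuous.prodMk ?_ continuous_const
    exact cγ.comp_continuous (by fun_prop) fun s => hmap s.2⟩
  have hγ₀ : ∀ t : UnitTime, γ₀ t = (γ 0, T, 0) +
      ∫ s in (0 : ℝ)..t, extendedField f g (γ₀ (projIcc 0 1 zero_le_one s)) := by
    intro t
    have key : ∀ s ∈ Icc (0 : ℝ) 1, HasDerivWithinAt (fun r => γ₀ (projIcc 0 1 zero_le_one r))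
        (extendedField f g (γ₀ (projIcc 0 1 zero_le_one s))) (Icc 0 1) s := by
      intro s hs
      have h1 : HasDerivWithinAt (fun r => (γ (T * r), T, (0 : ℝ)))
          (T • f (γ (T * s)), (0 : ℝ × ℝ)) (Icc 0 1) s :=
        (hasDerivWithinAt_comp_mul hmap (hode _ (hmap hs))).prodMk
          (hasDerivWithinAt_const _ _ _)
      have h2 : extendedField f g (γ₀ (projIcc 0 1 zero_le_one s))
          = (T • f (γ (T * s)), (0 : ℝ × ℝ)) := by
        rw [projIcc_of_mem zero_le_one hs]
        simp [extendedField, γ₀]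
      rw [h2]
      refine h1.congr_of_mem (fun r hr => ?_) hs
      rw [projIcc_of_mem zero_le_one hr]
      rfl
    have hsub : Icc (0 : ℝ) t ⊆ Icc 0 1 := Icc_subset_Icc_right t.2.2
    rw [intervalIntegral.integral_eq_sub_of_hasDerivAt_of_le t.2.1
      (f := fun r => γ₀ (projIcc 0 1 zero_le_one r)) (continuous_extend γ₀).continuousOn
      (fun s hs => (key s (hsub (Ioo_subset_Icc_self hs))).hasDerivAt
        (Icc_mem_nhds hs.1 (hs.2.trans_le t.2.2)))
      ((hW.continuous.comp (continuous_extend γ₀)).intervalIntegrable _ _)]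
    rw [projIcc_val, projIcc_of_mem zero_le_one (by simp : (0 : ℝ) ∈ Icc (0 : ℝ) 1)]
    simp [γ₀]
  obtain ⟨Ψ, hΨ, hΨ₀, hsol⟩ := exists_contDiffAt_solution hW γ₀ (γ 0, T, 0) hγ₀
  refine ⟨fun z => superposition ⟨Prod.fst, continuous_fst⟩ (Ψ z), ?_, ?_, ?_⟩
  · have h1 : ContDiff ℝ ∞ (superposition (⟨Prod.fst, continuous_fst⟩ : C(E × ℝ × ℝ, E)) :
        C(UnitTime, E × ℝ × ℝ) → C(UnitTime, E)) :=
      contDiff_superposition _ contDiff_fst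
    exact h1.contDiffAt.comp _ hΨ
  · intro s
    simp [hΨ₀, γ₀]
  · filter_upwards [hsol] with z hz
    have hcont : Continuous fun s => extendedField f g (Ψ z (projIcc 0 1 zero_le_one s)) :=
      hW.continuous.comp (continuous_extend (Ψ z))
    -- The extended field has no component in the parameter directions, so τ and ε are constant
    -- along solutions.
    have hpar : ∀ t : UnitTime, (Ψ z t).2 = z.2 := by
      intro t
      have := congrArg (ContinuousLinearMap.snd ℝ E (ℝ × ℝ)) (hz t)
      rw [map_add, ← ContinuousLinearMap.intervalIntegral_comp_comm _
        (hcont.intervalIntegrable _ _)] at this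
      simpa [extendedField] using this
    refine ⟨?_, fun s hs => ?_⟩
    · have := hz 0
      rw [Icc.coe_zero, intervalIntegral.integral_same, add_zero] at this
      simp [this]
    · have h1 : HasDerivAt (fun r : ℝ => z + ∫ q in (0 : ℝ)..r,
          extendedField f g (Ψ z (projIcc 0 1 zero_le_one q)))
          (extendedField f g (Ψ z (projIcc 0 1 zero_le_one s))) s :=
        (hcont.integral_hasStrictDerivAt 0 s).hasDerivAt.const_add z
      have h2 : HasDerivWithinAt (fun r : ℝ => (Ψ z (projIcc 0 1 zero_le_one r)))
          (extendedField f g (Ψ z (projIcc 0 1 zero_le_one s))) (Icc 0 1) s := by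
        refine h1.hasDerivWithinAt.congr_of_mem (fun r hr => ?_) hs
        rw [hz, projIcc_of_mem zero_le_one hr]
      have h3 := (ContinuousLinearMap.fst ℝ E (ℝ × ℝ)).hasFDerivAt.comp_hasDerivWithinAt s h2
      simpa [extendedField, hpar, Function.comp_def] using h3

end Parameters

/-! ### Stability of sign conditions on [0, 1] under perturbation. -/

theorem lt_of_hasDerivWithinAt_pos {φ φ' : ℝ → ℝ} {x y : ℝ} (hx : 0 ≤ x) (hxy : x < y) (hy : y ≤ 1)
    (hφ : ∀ s ∈ Icc (0 : ℝ) 1, HasDerivWithinAt φ (φ' s) (Icc 0 1) s)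
    (hpos : ∀ s ∈ Icc x y, 0 < φ' s) : φ x < φ y := by
  have hsub : Icc x y ⊆ Icc 0 1 := Icc_subset_Icc hx hy
  refine strictMonoOn_of_deriv_pos (convex_Icc x y)
    (fun s hs => ((hφ s (hsub hs)).continuousWithinAt).mono hsub) ?_
    (left_mem_Icc.2 hxy.le) (right_mem_Icc.2 hxy.le) hxy
  intro s hs
  rw [interior_Icc] at hs
  have h := (hφ s (hsub (Ioo_subset_Icc_self hs))).hasDerivAt
    (Icc_mem_nhds (hx.trans_lt hs.1) (hs.2.trans_le hy))
  rw [h.deriv]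
  exact hpos s (Ioo_subset_Icc_self hs)

section Positivity

variable {Z : Type*} [TopologicalSpace Z] {z₀ : Z} {a a' : Z → UnitTime → ℝ}

/-- A function on `[0, 1]` which is positive except possibly at `0`, where it increases, remains so
under small perturbations with nonnegative initial value. -/
theorem eventually_pos_of_increasing_at_start
    (ha : ∀ s, ContinuousAt (fun w : Z × UnitTime => a w.1 w.2) (z₀, s))
    (ha' : ContinuousAt (fun w : Z × UnitTime => a' w.1 w.2) (z₀, 0))
    (hderiv : ∀ᶠ z in 𝓝 z₀, ∀ s ∈ Icc (0 : ℝ) 1,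
      HasDerivWithinAt (fun r => a z (projIcc 0 1 zero_le_one r))
        (a' z (projIcc 0 1 zero_le_one s)) (Icc 0 1) s)
    (hpos : ∀ s : UnitTime, 0 < s → 0 < a z₀ s) (hstart : 0 < a' z₀ 0) :
    ∀ᶠ z in 𝓝 z₀, 0 ≤ a z 0 → ∀ s : UnitTime, 0 < s → 0 < a z s := by
  -- By compactness it suffices to argue near each s₀: continuity is enough for s₀ > 0, while at s₀
  -- = 0 the value may vanish and strict increase from a nonnegative start is used.
  have := (isCompact_univ (X := UnitTime)).eventually_forall_of_forall_eventually (x₀ := z₀)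
    (P := fun z s => 0 ≤ a z 0 → 0 < s → 0 < a z s) ?_
  · filter_upwards [this] with z hz h0 s hs using hz s (mem_univ s) h0 hs
  intro s₀ _
  rcases eq_or_lt_of_le s₀.2.1 with h0 | h0
  · obtain rfl : s₀ = 0 := Subtype.ext h0.symm
    have h1 : ∀ᶠ w : Z × UnitTime in 𝓝 z₀ ×ˢ 𝓝 0, 0 < a' w.1 w.2 := by
      rw [← nhds_prod_eq]
      exact ha'.eventually_const_lt hstart
    obtain ⟨u, hu, w, hw, huw⟩ := (eventually_prod_iff.1 h1)
    obtain ⟨η, hη, hball⟩ := Metric.eventually_nhds_iff.1 hw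
    rw [nhds_prod_eq]
    filter_upwards [(hu.and hderiv).prod_mk (Metric.ball_mem_nhds (0 : UnitTime) hη)]
      with ⟨z, s⟩ hz hnn hs
    have hsη : (s : ℝ) < η := by
      have : dist s _ < η := hz.2
      rw [Subtype.dist_eq, Icc.coe_zero, Real.dist_eq, sub_zero,
        abs_of_nonneg s.2.1] at this
      exact this
    have h := lt_of_hasDerivWithinAt_pos le_rfl (show (0 : ℝ) < s from hs) s.2.2 hz.1.2 ?_
    · rw [projIcc_val, projIcc_left] at h
      exact lt_of_le_of_lt hnn h
    · intro r hr
      refine @huw z hz.1.1 (projIcc 0 1 zero_le_one r) (hball ?_)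
      rw [projIcc_of_mem zero_le_one ⟨hr.1, hr.2.trans s.2.2⟩, Subtype.dist_eq, Icc.coe_zero,
        Real.dist_eq, sub_zero, abs_of_nonneg hr.1]
      exact hr.2.trans_lt hsη
  · filter_upwards [(ha s₀).eventually_const_lt (hpos s₀ h0)] with w hw _ _ using hw

/-- The variant of `eventually_pos_of_increasing_at_start` for the other end of `[0, 1]`. -/
theorem eventually_pos_of_decreasing_at_end
    (ha : ∀ s, ContinuousAt (fun w : Z × UnitTime => a w.1 w.2) (z₀, s))
    (ha' : ContinuousAt (fun w : Z × UnitTime => a' w.1 w.2) (z₀, 1))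
    (hderiv : ∀ᶠ z in 𝓝 z₀, ∀ s ∈ Icc (0 : ℝ) 1,
      HasDerivWithinAt (fun r => a z (projIcc 0 1 zero_le_one r))
        (a' z (projIcc 0 1 zero_le_one s)) (Icc 0 1) s)
    (hpos : ∀ s : UnitTime, s < 1 → 0 < a z₀ s) (hend : a' z₀ 1 < 0) :
    ∀ᶠ z in 𝓝 z₀, 0 ≤ a z 1 → ∀ s : UnitTime, s < 1 → 0 < a z s := by
  have := (isCompact_univ (X := UnitTime)).eventually_forall_of_forall_eventually (x₀ := z₀)
    (P := fun z s => 0 ≤ a z 1 → s < 1 → 0 < a z s) ?_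
  · filter_upwards [this] with z hz h0 s hs using hz s (mem_univ s) h0 hs
  intro s₀ _
  rcases eq_or_lt_of_le s₀.2.2 with h0 | h0
  · obtain rfl : s₀ = 1 := Subtype.ext h0
    have h1 : ∀ᶠ w : Z × UnitTime in 𝓝 z₀ ×ˢ 𝓝 1, a' w.1 w.2 < 0 := by
      rw [← nhds_prod_eq]
      exact ha'.eventually_lt_const hend
    obtain ⟨u, hu, w, hw, huw⟩ := (eventually_prod_iff.1 h1)
    obtain ⟨η, hη, hball⟩ := Metric.eventually_nhds_iff.1 hw
    rw [nhds_prod_eq]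
    filter_upwards [(hu.and hderiv).prod_mk (Metric.ball_mem_nhds (1 : UnitTime) hη)]
      with ⟨z, s⟩ hz hnn hs
    have hsη : 1 - (s : ℝ) < η := by
      have : dist s _ < η := hz.2
      rw [dist_comm, Subtype.dist_eq, Icc.coe_one, Real.dist_eq,
        abs_of_nonneg (sub_nonneg.2 s.2.2)] at this
      exact this
    have h := lt_of_hasDerivWithinAt_pos s.2.1 (show (s : ℝ) < 1 from hs) le_rfl
      (fun r hr => (hz.1.2 r hr).neg) ?_
    · simp only [Pi.neg_apply, projIcc_val, projIcc_right, neg_lt_neg_iff] at h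
      exact lt_of_le_of_lt hnn h
    · intro r hr
      refine neg_pos.2 (@huw z hz.1.1 (projIcc 0 1 zero_le_one r) (hball ?_))
      rw [projIcc_of_mem zero_le_one ⟨s.2.1.trans hr.1, hr.2⟩, dist_comm, Subtype.dist_eq,
        Icc.coe_one, Real.dist_eq, abs_of_nonneg (sub_nonneg.2 hr.2)]
      exact (sub_le_sub_left hr.1 1).trans_lt hsη
  · filter_upwards [(ha s₀).eventually_const_lt (hpos s₀ h0)] with w hw _ _ using hw

end Positivity

/-! ### Transit maps between hyperplanes. -/

section Transit

variable {E : Type u} [NormedAddCommGroup E] [NormedSpace ℝ E]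

/-- The velocity of the end point of a rescaled solution with respect to the time scale. -/
theorem hasDerivAt_rescaled_endpoint [ProperSpace E] {f g : E → E} (hf : ContDiff ℝ ∞ f)
    {γ : ℝ → E} {T : ℝ} (hT : 0 < T)
    (hode : ∀ t ∈ Icc 0 T, HasDerivWithinAt γ (f (γ t)) (Icc 0 T) t)
    {Ψ : E × ℝ × ℝ → C(UnitTime, E)}
    (hΨ : DifferentiableAt ℝ (fun τ : ℝ => Ψ (γ 0, τ, 0) 1) T)
    (hsol : ∀ᶠ z in 𝓝 (γ 0, T, (0 : ℝ)), Ψ z 0 = z.1 ∧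
        ∀ s ∈ Icc (0 : ℝ) 1, HasDerivWithinAt (fun r => Ψ z (projIcc 0 1 zero_le_one r))
          (z.2.1 • (f (Ψ z (projIcc 0 1 zero_le_one s))
            + z.2.2 • g (Ψ z (projIcc 0 1 zero_le_one s)))) (Icc 0 1) s) :
    HasDerivAt (fun τ : ℝ => Ψ (γ 0, τ, 0) 1) (f (γ T)) T := by
  -- The curve γ is controlled only on [0, T], so the comparison is made for τ ≤ T. The one-sided
  -- derivative is enough, since differentiability at T is already known.
  have h1 : ∀ᶠ τ in 𝓝[≤] T, Ψ (γ 0, τ, 0) 1 = γ τ := by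
    have hc : Tendsto (fun τ : ℝ => (γ 0, τ, (0 : ℝ))) (𝓝[≤] T) (𝓝 (γ 0, T, 0)) :=
      ((by fun_prop : Continuous fun τ : ℝ => (γ 0, τ, (0 : ℝ))).tendsto T).mono_left
        nhdsWithin_le_nhds
    filter_upwards [hc.eventually hsol, self_mem_nhdsWithin,
      mem_nhdsWithin_of_mem_nhds (Ioi_mem_nhds hT)] with τ hτ hτT hτ0
    have hmap : MapsTo (fun r => τ * r) (Icc 0 1) (Icc 0 T) := fun s hs =>
      ⟨mul_nonneg (le_of_lt hτ0) hs.1, (mul_le_of_le_one_right (le_of_lt hτ0) hs.2).trans hτT⟩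
    have := solution_eqOn (v := fun x => τ • f x) (T := 1)
      (α := fun r => Ψ (γ 0, τ, 0) (projIcc 0 1 zero_le_one r)) (β := fun r => γ (τ * r))
      ((hf.of_le (by simp)).const_smul τ) (fun s hs => by simpa using hτ.2 s hs)
      (fun s hs => hasDerivWithinAt_comp_mul hmap (hode _ (hmap hs)))
      (by simpa using hτ.1) (right_mem_Icc.2 zero_le_one)
    simpa using this
  have h2 : HasDerivWithinAt γ (f (γ T)) (Iic T) T :=
    (hode T (right_mem_Icc.2 hT.le)).mono_of_mem_nhdsWithin (Icc_mem_nhdsLE hT)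
  have h3 : HasDerivWithinAt (fun τ : ℝ => Ψ (γ 0, τ, 0) 1) (f (γ T)) (Iic T) T :=
    h2.congr_of_eventuallyEq h1 (h1.self_of_nhdsWithin self_mem_Iic)
  have h4 := (uniqueDiffOn_Iic T T self_mem_Iic).eq_deriv _ h3 hΨ.hasDerivAt.hasDerivWithinAt
  rw [h4]
  exact hΨ.hasDerivAt

/-- Near the arc `γ` on `[0, T]` in the sector `ℓi > 0, ℓo > 0`, entering through `ℓi = 0` and
leaving through `ℓo = 0`, there is a smooth family `Ψ (p, ε)` of arcs of `f + ε g` with initial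
value `p` and transit time `τ (p, ε)`, parametrized over the unit interval. -/
structure IsTransit (f g : E → E) (ℓi ℓo : E →L[ℝ] ℝ) (γ : ℝ → E) (T : ℝ)
    (τ : E × ℝ → ℝ) (Ψ : E × ℝ → C(UnitTime, E)) : Prop where
  contDiffAt_time : ContDiffAt ℝ ∞ τ (γ 0, 0)
  contDiffAt_curve : ContDiffAt ℝ ∞ Ψ (γ 0, 0)
  time_eq : τ (γ 0, 0) = T
  curve_eq : ∀ s : UnitTime, Ψ (γ 0, 0) s = γ (T * s)
  time_pos : ∀ᶠ z in 𝓝 (γ 0, (0 : ℝ)), 0 < τ z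
  curve_zero : ∀ᶠ z in 𝓝 (γ 0, (0 : ℝ)), Ψ z 0 = z.1
  ode : ∀ᶠ z in 𝓝 (γ 0, (0 : ℝ)), ∀ s ∈ Icc (0 : ℝ) 1,
    HasDerivWithinAt (fun r => Ψ z (projIcc 0 1 zero_le_one r))
      (τ z • (f (Ψ z (projIcc 0 1 zero_le_one s))
        + z.2 • g (Ψ z (projIcc 0 1 zero_le_one s)))) (Icc 0 1) s
  exit_eq : ∀ᶠ z in 𝓝 (γ 0, (0 : ℝ)), ℓo (Ψ z 1) = 0
  pos_in : ∀ᶠ z in 𝓝 (γ 0, (0 : ℝ)), ℓi z.1 = 0 → ∀ s : UnitTime, 0 < s → 0 < ℓi (Ψ z s)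
  pos_out : ∀ᶠ z in 𝓝 (γ 0, (0 : ℝ)), ∀ s : UnitTime, s < 1 → 0 < ℓo (Ψ z s)

theorem continuousAt_eval {Z K E : Type*} [NormedAddCommGroup E] [TopologicalSpace Z]
    [TopologicalSpace K] [CompactSpace K]
    {Ψ : Z → C(K, E)} {z₀ : Z} (h : ContinuousAt Ψ z₀) (s : K) :
    ContinuousAt (fun w : Z × K => Ψ w.1 w.2) (z₀, s) := by
  have h1 : ContinuousAt (fun w : Z × K => (Ψ w.1, w.2)) (z₀, s) :=
    (h.comp (f := Prod.fst) (x := (z₀, s)) continuousAt_fst).prodMk continuousAt_snd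
  exact (ContinuousEval.continuous_eval (F := C(K, E))).continuousAt.comp h1

/-- The exit time solves ℓo = 0 at the end of the rescaled solution; its derivative in the time
scale is ℓo(f(γ T)) ≠ 0. The family is defined for initial points in a full neighbourhood, so it can
be differentiated in the ambient space; only positivity of ℓi requires the initial point to lie on
the hyperplane. -/
theorem exists_isTransit [ProperSpace E] {f g : E → E} (hf : ContDiff ℝ ∞ f)
    (hg : ContDiff ℝ ∞ g) {ℓi ℓo : E →L[ℝ] ℝ} {γ : ℝ → E} {T : ℝ} (hT : 0 < T)
    (hode : ∀ t ∈ Icc 0 T, HasDerivWithinAt γ (f (γ t)) (Icc 0 T) t)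
    (hpos_in : ∀ t ∈ Ioc 0 T, 0 < ℓi (γ t)) (hpos_out : ∀ t ∈ Ico 0 T, 0 < ℓo (γ t))
    (hexit : ℓo (γ T) = 0) (htrans_in : 0 < ℓi (f (γ 0))) (htrans_out : ℓo (f (γ T)) < 0) :
    ∃ τ Ψ, IsTransit f g ℓi ℓo γ T τ Ψ := by
  obtain ⟨Ψ, hΨ, hΨ₀, hsol⟩ := exists_contDiffAt_rescaled_solution hf hg hT hode
  let σ : (E × ℝ) × ℝ → E × ℝ × ℝ := fun w => (w.1.1, w.2, w.1.2)
  have hσ : ContDiff ℝ ∞ σ := by fun_prop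
  let e : (E × ℝ) × ℝ → ℝ := fun w => ℓo (Ψ (σ w) 1)
  have heval : ContDiffAt ℝ ∞ (fun z => Ψ z 1) (γ 0, T, 0) :=
    ((ContinuousMap.evalCLM ℝ (1 : UnitTime) : C(UnitTime, E) →L[ℝ] E).contDiff.contDiffAt).comp
      _ hΨ
  have he : ContDiffAt ℝ ∞ e ((γ 0, 0), T) :=
    ℓo.contDiff.contDiffAt.comp _
      (ContDiffAt.comp (g := fun z => Ψ z 1) _ heval hσ.contDiffAt)
  have hpart : (fderiv ℝ e ((γ 0, 0), T) ∘L .inr ℝ (E × ℝ) ℝ) 1 = ℓo (f (γ T)) := by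
    have hd : DifferentiableAt ℝ (fun τ : ℝ => Ψ (γ 0, τ, 0) 1) T :=
      DifferentiableAt.comp (g := fun z => Ψ z 1) T (heval.differentiableAt (by simp))
        (by fun_prop : DifferentiableAt ℝ (fun τ : ℝ => (γ 0, τ, (0 : ℝ))) T)
    have h1 := ℓo.hasFDerivAt.comp_hasDerivAt T
      (hasDerivAt_rescaled_endpoint hf hT hode hd hsol)
    have h2 : HasDerivAt (fun τ : ℝ => ((γ 0, (0 : ℝ)), τ)) ((0 : E × ℝ), (1 : ℝ)) T :=
      (hasDerivAt_const T _).prodMk (hasDerivAt_id T)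
    have h3 := (he.differentiableAt (by simp)).hasFDerivAt.comp_hasDerivAt T h2
    exact h3.unique h1
  have hinv : (fderiv ℝ e ((γ 0, 0), T) ∘L .inr ℝ (E × ℝ) ℝ).IsInvertible := by
    refine ⟨ContinuousLinearEquiv.unitsEquivAut ℝ (Units.mk0 _ htrans_out.ne), ?_⟩
    ext
    rw [hpart]
    simp
  have he0 : e ((γ 0, 0), T) = 0 := by
    simp [e, σ, hΨ₀, hexit]
  let τ : E × ℝ → ℝ := he.implicitFunction (by simp) hinv
  have hτ : ContDiffAt ℝ ∞ τ (γ 0, 0) := he.contDiffAt_implicitFunction (by simp) hinv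
  have hτ₀ : τ (γ 0, 0) = T := he.implicitFunction_apply_self (by simp) hinv
  have hτe : ∀ᶠ z in 𝓝 (γ 0, (0 : ℝ)), e (z, τ z) = 0 := by
    filter_upwards [he.eventually_apply_implicitFunction (by simp) hinv] with z hz
    rw [hz, he0]
  let ρ : E × ℝ → E × ℝ × ℝ := fun z => (z.1, τ z, z.2)
  have hρ : ContDiffAt ℝ ∞ ρ (γ 0, 0) := contDiffAt_fst.prodMk (hτ.prodMk contDiffAt_snd)
  have hρ₀ : ρ (γ 0, 0) = (γ 0, T, 0) := by simp [ρ, hτ₀]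
  have hρt : Tendsto ρ (𝓝 (γ 0, 0)) (𝓝 (γ 0, T, 0)) := hρ₀ ▸ hρ.continuousAt
  -- Substituting the exit time for the free time scale turns the solutions into the family of arcs.
  have hΦ : ContDiffAt ℝ ∞ (fun z => Ψ (ρ z)) (γ 0, 0) :=
    ContDiffAt.comp (g := Ψ) _ (hρ₀ ▸ hΨ) hρ
  have hΦ₀ : ∀ s : UnitTime, Ψ (ρ (γ 0, 0)) s = γ (T * s) := fun s => by rw [hρ₀, hΨ₀]
  have hsol' := hρt.eventually hsol
  have hcont := hΦ.continuousAt
  have hmem : ∀ s : UnitTime, 0 < s → T * (s : ℝ) ∈ Ioc 0 T := fun s hs =>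
    ⟨mul_pos hT hs, mul_le_of_le_one_right hT.le s.2.2⟩
  have hmem' : ∀ s : UnitTime, s < 1 → T * (s : ℝ) ∈ Ico 0 T := fun s hs =>
    ⟨mul_nonneg hT.le s.2.1, mul_lt_of_lt_one_right hT hs⟩
  have hfield : ∀ s : UnitTime, ContinuousAt (fun w : (E × ℝ) × UnitTime =>
      τ w.1 • (f (Ψ (ρ w.1) w.2) + w.1.2 • g (Ψ (ρ w.1) w.2))) ((γ 0, 0), s) := by
    intro s
    have h1 := continuousAt_eval hcont s
    have h2 : ContinuousAt (fun w : (E × ℝ) × UnitTime => τ w.1) ((γ 0, 0), s) :=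
      hτ.continuousAt.comp (f := Prod.fst) continuousAt_fst
    have h3 : ContinuousAt (fun w : (E × ℝ) × UnitTime => w.1.2) ((γ 0, 0), s) := by fun_prop
    exact h2.smul ((hf.continuous.continuousAt.comp h1).add
      (h3.smul (hg.continuous.continuousAt.comp h1)))
  have hfun : ∀ ℓ : E →L[ℝ] ℝ, ∀ s : UnitTime, ContinuousAt (fun w : (E × ℝ) × UnitTime =>
      ℓ (Ψ (ρ w.1) w.2)) ((γ 0, 0), s) := fun ℓ s =>
    ℓ.continuous.continuousAt.comp (continuousAt_eval hcont s)
  have hderiv : ∀ ℓ : E →L[ℝ] ℝ, ∀ᶠ z in 𝓝 (γ 0, (0 : ℝ)), ∀ s ∈ Icc (0 : ℝ) 1,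
      HasDerivWithinAt (fun r => ℓ (Ψ (ρ z) (projIcc 0 1 zero_le_one r)))
        (ℓ (τ z • (f (Ψ (ρ z) (projIcc 0 1 zero_le_one s))
        + z.2 • g (Ψ (ρ z) (projIcc 0 1 zero_le_one s))))) (Icc 0 1) s := by
    intro ℓ
    filter_upwards [hsol'] with z hz s hs
    exact ℓ.hasFDerivAt.comp_hasDerivWithinAt s (hz.2 s hs)
  refine ⟨τ, fun z => Ψ (ρ z), hτ, hΦ, hτ₀, hΦ₀, ?_, ?_, ?_, hτe, ?_, ?_⟩
  · exact hτ.continuousAt.eventually_const_lt (by rwa [hτ₀])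
  · exact hsol'.mono fun z hz => hz.1
  · exact hsol'.mono fun z hz => hz.2
  · have := eventually_pos_of_increasing_at_start (a := fun z s => ℓi (Ψ (ρ z) s))
      (a' := fun z s => ℓi (τ z • (f (Ψ (ρ z) s) + z.2 • g (Ψ (ρ z) s))))
      (hfun ℓi) (ℓi.continuous.continuousAt.comp (hfield 0)) (hderiv ℓi)
      (fun s hs => by rw [hΦ₀]; exact hpos_in _ (hmem s hs))
      (by simp only [hΦ₀, hτ₀]; simpa using mul_pos hT htrans_in)
    filter_upwards [this, hsol'] with z hz h0 hin
    refine hz ?_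
    rw [h0.1]
    exact hin.ge
  · have := eventually_pos_of_decreasing_at_end (a := fun z s => ℓo (Ψ (ρ z) s))
      (a' := fun z s => ℓo (τ z • (f (Ψ (ρ z) s) + z.2 • g (Ψ (ρ z) s))))
      (hfun ℓo) (ℓo.continuous.continuousAt.comp (hfield 1)) (hderiv ℓo)
      (fun s hs => by rw [hΦ₀]; exact hpos_out _ (hmem' s hs))
      (by simp only [hΦ₀, hτ₀]; simpa using mul_neg_of_pos_of_neg hT htrans_out)
    filter_upwards [this, hτe] with z hz h0
    exact hz h0.ge

end Transit

/-! ### First integrals: transversality and increments along perturbed arcs. -/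

section FirstIntegral

variable {E : Type u} [NormedAddCommGroup E] [NormedSpace ℝ E]
  {F : Type*} [NormedAddCommGroup F] [NormedSpace ℝ F]

/-- A solution leaving the hyperplane `ℓ = 0` is transversal to it, if there is a first integral
whose derivative is injective on the hyperplane. -/
theorem pos_velocity_of_first_integral [ProperSpace E] {v : E → E} (hv : ContDiff ℝ 1 v)
    {α : ℝ → E} {T : ℝ} (hT : 0 < T)
    (hode : ∀ t ∈ Icc 0 T, HasDerivWithinAt α (v (α t)) (Icc 0 T) t)
    {ℓ : E →L[ℝ] ℝ} {U : Set E} (hU : IsOpen U) {K : E → F} (hK : ContDiffOn ℝ 1 K U)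
    (h0U : α 0 ∈ U) (hint : ∀ t ∈ Ioo 0 T, fderiv ℝ K (α t) (v (α t)) = 0)
    (hℓ0 : ℓ (α 0) = 0) (hℓ : ∀ t ∈ Ioc 0 T, 0 < ℓ (α t))
    (hker : ∀ w, ℓ w = 0 → fderiv ℝ K (α 0) w = 0 → w = 0) : 0 < ℓ (v (α 0)) := by
  have h0 : (0 : ℝ) ∈ Icc 0 T := left_mem_Icc.2 hT.le
  -- From an equilibrium the solution would be constant and could not leave the hyperplane.
  have hne : v (α 0) ≠ 0 := by
    intro hv0
    have := solution_eqOn hv hode (β := fun _ => α 0)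
      (fun t _ => by simpa [hv0] using hasDerivWithinAt_const t (Icc 0 T) (α 0)) rfl
      (right_mem_Icc.2 hT.le)
    have h2 := hℓ T (right_mem_Ioc.2 hT)
    rw [this, hℓ0] at h2
    exact lt_irrefl _ h2
  -- The identity is assumed only at interior times and reaches the end point by continuity.
  have hkey : fderiv ℝ K (α 0) (v (α 0)) = 0 := by
    have hc : ContinuousWithinAt (fun t => fderiv ℝ K (α t) (v (α t))) (Ioi 0) 0 := by
      have hα : ContinuousWithinAt α (Ioi 0) 0 := by
        have := (hode 0 h0).continuousWithinAt.mono Ioo_subset_Icc_self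
        exact this.mono_of_mem_nhdsWithin (Ioo_mem_nhdsGT hT)
      have h1 : ContinuousAt (fderiv ℝ K) (α 0) :=
        (hK.continuousOn_fderiv_of_isOpen hU le_rfl).continuousAt (hU.mem_nhds h0U)
      exact (h1.comp_continuousWithinAt hα).clm_apply
        (hv.continuous.continuousAt.comp_continuousWithinAt hα)
    refine tendsto_nhds_unique hc (tendsto_const_nhds.congr' ?_)
    filter_upwards [Ioo_mem_nhdsGT hT] with t ht using (hint t ht).symm
  have hge : 0 ≤ ℓ (v (α 0)) := by
    have hd : HasDerivWithinAt (fun t => ℓ (α t)) (ℓ (v (α 0))) (Ici 0) 0 :=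
      (ℓ.hasFDerivAt.comp_hasDerivWithinAt 0 (hode 0 h0)).mono_of_mem_nhdsWithin
        (Icc_mem_nhdsGE hT)
    have hs := (hasDerivWithinAt_iff_tendsto_slope' self_notMem_Ioi).1 hd.Ioi_of_Ici
    refine ge_of_tendsto hs ?_
    filter_upwards [Ioo_mem_nhdsGT hT] with t ht
    rw [slope_def_field, hℓ0, sub_zero, sub_zero]
    exact (div_pos (hℓ t (Ioo_subset_Ioc_self ht)) ht.1).le
  -- A tangential velocity would lie in the kernel of the derivative on the hyperplane, hence
  -- vanish.
  exact lt_of_le_of_ne hge fun h => hne (hker _ h.symm hkey)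

/-- The variant of `pos_velocity_of_first_integral` for the end of the solution. -/
theorem neg_velocity_of_first_integral [ProperSpace E] {v : E → E} (hv : ContDiff ℝ 1 v)
    {α : ℝ → E} {T : ℝ} (hT : 0 < T)
    (hode : ∀ t ∈ Icc 0 T, HasDerivWithinAt α (v (α t)) (Icc 0 T) t)
    {ℓ : E →L[ℝ] ℝ} {U : Set E} (hU : IsOpen U) {K : E → F} (hK : ContDiffOn ℝ 1 K U)
    (hTU : α T ∈ U) (hint : ∀ t ∈ Ioo 0 T, fderiv ℝ K (α t) (v (α t)) = 0)
    (hℓT : ℓ (α T) = 0) (hℓ : ∀ t ∈ Ico 0 T, 0 < ℓ (α t))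
    (hker : ∀ w, ℓ w = 0 → fderiv ℝ K (α T) w = 0 → w = 0) : ℓ (v (α T)) < 0 := by
  have hmap : MapsTo (fun t => T - t) (Icc 0 T) (Icc 0 T) := fun t ht => by
    constructor <;> linarith [ht.1, ht.2]
  have := pos_velocity_of_first_integral (v := fun x => -v x) hv.neg (α := fun t => α (T - t)) hT
    (fun t ht => by
      have h1 : HasDerivWithinAt (fun t : ℝ => T - t) (-1) (Icc 0 T) t := by
        simpa using ((hasDerivAt_id t).const_sub T).hasDerivWithinAt
      simpa [Function.comp_def] using (hode _ (hmap ht)).scomp t h1 hmap)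
    (ℓ := ℓ) hU hK (by simpa using hTU)
    (fun t ht => by
      rw [map_neg, hint (T - t) ⟨by linarith [ht.2], by linarith [ht.1]⟩, neg_zero])
    (by simpa using hℓT) (fun t ht => hℓ _ ⟨by linarith [ht.2], by linarith [ht.1]⟩)
    (by simpa using hker)
  simpa using this

theorem tendsto_integral_of_continuousAt {Z : Type*} [TopologicalSpace Z]
    {E : Type*} [NormedAddCommGroup E]
    {Ψ : Z → C(UnitTime, E)} {z₀ : Z} (hΨ : ContinuousAt Ψ z₀) {U : Set E} (hU : IsOpen U)
    {φ : E → F} (hφ : ContinuousOn φ U) (hmem : ∀ s, Ψ z₀ s ∈ U) :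
    Tendsto (fun z => ∫ s in (0 : ℝ)..1, φ (Ψ z (projIcc 0 1 zero_le_one s))) (𝓝 z₀)
      (𝓝 (∫ s in (0 : ℝ)..1, φ (Ψ z₀ (projIcc 0 1 zero_le_one s)))) := by
  rw [Metric.tendsto_nhds]
  intro c hc
  have h1 := (isCompact_univ (X := UnitTime)).eventually_forall_of_forall_eventually (x₀ := z₀)
    (P := fun z s => Ψ z s ∈ U ∧ dist (φ (Ψ z s)) (φ (Ψ z₀ s)) < c / 2) (by
      intro s _
      have he := continuousAt_eval hΨ s
      have he₀ : ContinuousAt (fun w : Z × UnitTime => Ψ z₀ w.2) (z₀, s) := by fun_prop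
      have hφs : ContinuousAt φ (Ψ z₀ s) := hφ.continuousAt (hU.mem_nhds (hmem s))
      have hd : ContinuousAt (fun w : Z × UnitTime =>
          dist (φ (Ψ w.1 w.2)) (φ (Ψ z₀ w.2))) (z₀, s) :=
        (ContinuousAt.comp (f := fun w : Z × UnitTime => Ψ w.1 w.2) hφs he).dist
          (ContinuousAt.comp (f := fun w : Z × UnitTime => Ψ z₀ w.2) hφs he₀)
      exact (he.eventually (hU.mem_nhds (hmem s))).and
        (hd.eventually_lt_const (by simpa using half_pos hc)))
  filter_upwards [h1] with z hz
  have hcz : ∀ z, (∀ s, Ψ z s ∈ U) →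
      Continuous fun s : ℝ => φ (Ψ z (projIcc 0 1 zero_le_one s)) := fun z hz =>
    hφ.comp_continuous (continuous_extend (Ψ z)) fun s => hz _
  rw [dist_eq_norm, ← intervalIntegral.integral_sub
    ((hcz z fun s => (hz s (mem_univ s)).1).intervalIntegrable _ _)
    ((hcz z₀ hmem).intervalIntegrable _ _)]
  refine lt_of_le_of_lt (intervalIntegral.norm_integral_le_of_norm_le_const (C := c / 2)
    fun s _ => ?_) (by simpa using half_lt_self hc)
  rw [← dist_eq_norm]
  exact (hz _ (mem_univ _)).2.le

namespace IsTransit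

variable {f g : E → E} {ℓi ℓo : E →L[ℝ] ℝ} {γ : ℝ → E} {T : ℝ} {τ : E × ℝ → ℝ}
  {Ψ : E × ℝ → C(UnitTime, E)}

theorem eventually_mem (h : IsTransit f g ℓi ℓo γ T τ Ψ) (hT : 0 ≤ T) {U : Set E} (hU : IsOpen U)
    (hmem : ∀ t ∈ Icc 0 T, γ t ∈ U) : ∀ᶠ z in 𝓝 (γ 0, (0 : ℝ)), ∀ s, Ψ z s ∈ U := by
  have := (isCompact_univ (X := UnitTime)).eventually_forall_of_forall_eventually
    (x₀ := (γ 0, (0 : ℝ))) (P := fun z s => Ψ z s ∈ U) (fun s _ => by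
      refine (continuousAt_eval h.contDiffAt_curve.continuousAt s).eventually (hU.mem_nhds ?_)
      change Ψ (γ 0, 0) s ∈ U
      rw [h.curve_eq]
      exact hmem _ ⟨mul_nonneg hT s.2.1, mul_le_of_le_one_right hT s.2.2⟩)
  exact this.mono fun z hz s => hz s (mem_univ s)

/-- The increment of a first integral of `f` along the arcs of `f + ε g`. -/
theorem exists_increment [CompleteSpace F] (h : IsTransit f g ℓi ℓo γ T τ Ψ) (hT : 0 ≤ T)
    (hg : Continuous g) {U : Set E} (hU : IsOpen U) (hmem : ∀ t ∈ Icc 0 T, γ t ∈ U)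
    {K : E → F} (hK : ContDiffOn ℝ 1 K U)
    (hint : ∀ x ∈ U, 0 < ℓi x → 0 < ℓo x → fderiv ℝ K x (f x) = 0) :
    ∃ I : E × ℝ → F, Tendsto I (𝓝 (γ 0, 0)) (𝓝 (∫ t in (0 : ℝ)..T, fderiv ℝ K (γ t) (g (γ t)))) ∧
      ∀ᶠ z in 𝓝 (γ 0, (0 : ℝ)), ℓi z.1 = 0 → K (Ψ z 1) - K z.1 = z.2 • I z := by
  have hcont : ContinuousOn (fun x => fderiv ℝ K x (g x)) U :=
    (hK.continuousOn_fderiv_of_isOpen hU le_rfl).clm_apply hg.continuousOn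
  refine ⟨fun z => τ z • ∫ s in (0 : ℝ)..1, fderiv ℝ K (Ψ z (projIcc 0 1 zero_le_one s))
    (g (Ψ z (projIcc 0 1 zero_le_one s))), ?_, ?_⟩
  · have h1 := tendsto_integral_of_continuousAt h.contDiffAt_curve.continuousAt hU hcont
      (fun s => by
        rw [h.curve_eq]
        exact hmem _ ⟨mul_nonneg hT s.2.1, mul_le_of_le_one_right hT s.2.2⟩)
    have h2 : Tendsto τ (𝓝 (γ 0, 0)) (𝓝 T) := by
      have := h.contDiffAt_time.continuousAt.tendsto
      rwa [h.time_eq] at this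
    have h3 := h2.smul h1
    convert h3 using 2
    have h4 := intervalIntegral.smul_integral_comp_mul_left (a := 0) (b := 1)
      (fun t => fderiv ℝ K (γ t) (g (γ t))) T
    rw [mul_zero, mul_one] at h4
    rw [← h4]
    congr 1
    refine intervalIntegral.integral_congr fun s hs => ?_
    rw [uIcc_of_le zero_le_one] at hs
    simp only [projIcc_of_mem zero_le_one hs, h.curve_eq]
  · filter_upwards [h.eventually_mem hT hU hmem, h.curve_zero, h.ode, h.pos_in, h.pos_out]
      with z hzU hz0 hode hin hout hz
    have hderiv : ∀ s ∈ Ioo (0 : ℝ) 1,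
        HasDerivAt (fun r => K (Ψ z (projIcc 0 1 zero_le_one r)))
        ((z.2 * τ z) • fderiv ℝ K (Ψ z (projIcc 0 1 zero_le_one s))
          (g (Ψ z (projIcc 0 1 zero_le_one s)))) s := by
      intro s hs
      have hs' := Ioo_subset_Icc_self hs
      have hp := projIcc_of_mem zero_le_one hs'
      -- At interior times the arc is in the open sector, so the f-part of the velocity does not
      -- change K and only ε g contributes.
      have hx := hint _ (hzU (projIcc 0 1 zero_le_one s))
        (hin hz _ (by rw [hp]; exact hs.1)) (hout _ (by rw [hp]; exact hs.2))
      have h1 : HasFDerivAt K (fderiv ℝ K (Ψ z (projIcc 0 1 zero_le_one s)))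
          (Ψ z (projIcc 0 1 zero_le_one s)) :=
        ((hK.differentiableOn one_ne_zero).differentiableAt
          (hU.mem_nhds (hzU _))).hasFDerivAt
      have h2 := h1.comp_hasDerivAt s ((hode s hs').hasDerivAt (Icc_mem_nhds hs.1 hs.2))
      rw [map_smul, map_add, hx, zero_add, map_smul, smul_smul, mul_comm] at h2
      exact h2
    have hc1 : Continuous fun r : ℝ => K (Ψ z (projIcc 0 1 zero_le_one r)) :=
      hK.continuousOn.comp_continuous (continuous_extend (Ψ z)) fun s => hzU _
    have hc2 : Continuous fun r : ℝ => (z.2 * τ z) • fderiv ℝ K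
        (Ψ z (projIcc 0 1 zero_le_one r)) (g (Ψ z (projIcc 0 1 zero_le_one r))) :=
      (hcont.comp_continuous (continuous_extend (Ψ z)) fun s => hzU _).const_smul _
    have h3 := intervalIntegral.integral_eq_sub_of_hasDerivAt_of_le zero_le_one
      hc1.continuousOn hderiv (hc2.intervalIntegrable _ _)
    rw [intervalIntegral.integral_smul, projIcc_left, projIcc_right] at h3
    rw [smul_smul, h3]
    change _ = K (Ψ z 1) - K (Ψ z 0)
    rw [hz0]

end IsTransit

end FirstIntegral

/-! ### Arcs in the four quadrants, in terms of entry and exit functionals. -/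

section Arcs

variable {m : ℕ}

/-- The coordinate functional vanishing on the entrance of quadrant `k` and positive inside. -/
def entryFunctional : Fin 4 → Phase m →L[ℝ] ℝ :=
  ![ContinuousLinearMap.proj 0, -ContinuousLinearMap.proj 1, -ContinuousLinearMap.proj 0,
    ContinuousLinearMap.proj 1]

/-- The coordinate functional vanishing on the exit of quadrant `k` and positive inside. -/
def exitFunctional : Fin 4 → Phase m →L[ℝ] ℝ :=
  ![ContinuousLinearMap.proj 1, ContinuousLinearMap.proj 0, -ContinuousLinearMap.proj 1,
    -ContinuousLinearMap.proj 0]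

theorem mem_switching_iff {k : Fin 4} {x : Phase m} :
    x ∈ switching k ↔ entryFunctional k x = 0 ∧ 0 < exitFunctional k x := by
  fin_cases k <;> simp [switching, entryFunctional, exitFunctional]

theorem mem_switching_succ_iff {k : Fin 4} {x : Phase m} :
    x ∈ switching (k + 1) ↔ exitFunctional k x = 0 ∧ 0 < entryFunctional k x := by
  fin_cases k <;> simp [switching, entryFunctional, exitFunctional]

theorem mem_openQuadrant_iff {k : Fin 4} {x : Phase m} :
    x ∈ openQuadrant k ↔ 0 < entryFunctional k x ∧ 0 < exitFunctional k x := by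
  fin_cases k <;> simp [openQuadrant, entryFunctional, exitFunctional, and_comm]

theorem openQuadrant_subset_region (k : Fin 4) :
    (openQuadrant k : Set (Phase m)) ⊆ region k := by
  intro x hx
  fin_cases k
  · exact ⟨hx.1.le, hx.2.le⟩
  all_goals exact hx

namespace IsArc

variable {k : Fin 4} {v : Phase m → Phase m} {γ : ℝ → Phase m} {T : ℝ} {p q : Phase m}

theorem entry_pos (h : IsArc k v γ T p q) : ∀ t ∈ Ioc 0 T, 0 < entryFunctional k (γ t) := by
  intro t ht
  rcases eq_or_lt_of_le ht.2 with rfl | h1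
  · rw [h.end_eq]
    exact (mem_switching_succ_iff.1 h.end_mem).2
  · exact (mem_openQuadrant_iff.1 (h.interior t ⟨ht.1, h1⟩)).1

theorem exit_pos (h : IsArc k v γ T p q) : ∀ t ∈ Ico 0 T, 0 < exitFunctional k (γ t) := by
  intro t ht
  rcases eq_or_lt_of_le ht.1 with rfl | h1
  · rw [h.start_eq]
    exact (mem_switching_iff.1 h.start_mem).2
  · exact (mem_openQuadrant_iff.1 (h.interior t ⟨h1, ht.2⟩)).2

/-- A longer arc would agree with the shorter one up to its exit, where the exit functional vanishes
although it is positive before the end of the longer arc. -/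
theorem time_le {γ' : ℝ → Phase m} {T' : ℝ} {q' : Phase m} (hv : ContDiff ℝ 1 v)
    (h : IsArc k v γ T p q) (h' : IsArc k v γ' T' p q') : T' ≤ T := by
  by_contra! hlt
  have hsub : Icc 0 T ⊆ Icc 0 T' := Icc_subset_Icc_right hlt.le
  have heq := solution_eqOn hv h.ode (fun t ht => (h'.ode t (hsub ht)).mono hsub)
    (h.start_eq.trans h'.start_eq.symm) (right_mem_Icc.2 h.pos.le)
  have h1 := h'.exit_pos T ⟨h.pos.le, hlt⟩
  rw [← heq, h.end_eq, (mem_switching_succ_iff.1 h.end_mem).1] at h1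
  exact lt_irrefl _ h1

/-- An arc is determined by its initial point. -/
theorem unique {γ' : ℝ → Phase m} {T' : ℝ} {q' : Phase m} (hv : ContDiff ℝ 1 v)
    (h : IsArc k v γ T p q) (h' : IsArc k v γ' T' p q') :
    T = T' ∧ EqOn γ γ' (Icc 0 T) ∧ q = q' := by
  obtain rfl : T = T' := le_antisymm (time_le hv h' h) (time_le hv h h')
  have heq := solution_eqOn hv h.ode h'.ode (h.start_eq.trans h'.start_eq.symm)
  exact ⟨rfl, heq, by rw [← h.end_eq, ← h'.end_eq]; exact heq (right_mem_Icc.2 h.pos.le)⟩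

end IsArc

theorem IsReturn.unique {v : Fin 4 → Phase m → Phase m} (hv : ∀ k, ContDiff ℝ 1 (v k))
    {p q q' : Phase m} (h : IsReturn v p q) (h' : IsReturn v p q') : q = q' := by
  obtain ⟨b, c, e, ⟨_, _, h0⟩, ⟨_, _, h1⟩, ⟨_, _, h2⟩, ⟨_, _, h3⟩⟩ := h
  obtain ⟨b', c', e', ⟨_, _, h0'⟩, ⟨_, _, h1'⟩, ⟨_, _, h2'⟩, ⟨_, _, h3'⟩⟩ := h'
  obtain rfl := (h0.unique (hv 0) h0').2.2
  obtain rfl := (h1.unique (hv 1) h1').2.2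
  obtain rfl := (h2.unique (hv 2) h2').2.2
  exact (h3.unique (hv 3) h3').2.2

theorem returnPoint_eq {v : Fin 4 → Phase m → Phase m} (hv : ∀ k, ContDiff ℝ 1 (v k))
    {p q : Phase m} (h : IsReturn v p q) : returnPoint v p = q :=
  (Classical.epsilon_spec ⟨q, h⟩ : IsReturn v p (returnPoint v p)).unique hv h

/-- A smooth local transit map through quadrant `k`, near an arc `γ` of the field `f` from `p` to
`q`, for the perturbed field `f + ε g`; the last condition is the first order expansion of the
increment of a first integral `K` of `f`. -/
structure IsTransitMap (k : Fin 4) (f g : Phase m → Phase m) (K : Phase m → Level m)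
    (γ : ℝ → Phase m) (T : ℝ) (p q : Phase m) (Q : Phase m × ℝ → Phase m) : Prop where
  contDiffAt : ContDiffAt ℝ ∞ Q (p, 0)
  map_eq : Q (p, 0) = q
  exit_eq : ∀ᶠ z in 𝓝 (p, (0 : ℝ)), exitFunctional k (Q z) = 0
  arc : ∀ δ > 0, ∀ᶠ z in 𝓝 (p, (0 : ℝ)), z.1 ∈ switching k → ∃ c τ,
    IsArc k (fun x => f x + z.2 • g x) c τ z.1 (Q z) ∧
      c '' Icc 0 τ ⊆ Metric.thickening δ (γ '' Icc 0 T)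
  increment : ∃ I : Phase m × ℝ → Level m, Tendsto I (𝓝 (p, 0)) (𝓝 (arcIntegral K g γ T)) ∧
    ∀ᶠ z in 𝓝 (p, (0 : ℝ)), z.1 ∈ switching k → K (Q z) - K z.1 = z.2 • I z

theorem IsTransit.isArc {k : Fin 4} {f g : Phase m → Phase m} {γ : ℝ → Phase m} {T : ℝ}
    {τ : Phase m × ℝ → ℝ} {Ψ : Phase m × ℝ → C(UnitTime, Phase m)}
    (h : IsTransit f g (entryFunctional k) (exitFunctional k) γ T τ Ψ) :
    ∀ᶠ z in 𝓝 (γ 0, (0 : ℝ)), z.1 ∈ switching k →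
      IsArc k (fun x => f x + z.2 • g x)
        (fun t => Ψ z (projIcc 0 1 zero_le_one ((τ z)⁻¹ * t))) (τ z) z.1 (Ψ z 1) := by
  filter_upwards [h.time_pos, h.curve_zero, h.ode, h.exit_eq, h.pos_in, h.pos_out]
    with z hτ h0 hode hexit hin hout hz
  have hentry := (mem_switching_iff.1 hz).1
  have hmap : MapsTo (fun t => (τ z)⁻¹ * t) (Icc 0 (τ z)) (Icc 0 1) := fun t ht =>
    ⟨mul_nonneg (inv_nonneg.2 hτ.le) ht.1, by
      rw [inv_mul_le_iff₀ hτ, mul_one]; exact ht.2⟩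
  refine ⟨hτ, hz, mem_switching_succ_iff.2 ⟨hexit, hin hentry 1 zero_lt_one⟩, ?_, ?_, ?_, ?_⟩
  · simp only [mul_zero, projIcc_left]
    exact h0
  · simp only [inv_mul_cancel₀ hτ.ne', projIcc_right]
    rfl
  · intro t ht
    have := hasDerivWithinAt_comp_mul hmap (hode _ (hmap ht))
    rwa [smul_smul, inv_mul_cancel₀ hτ.ne', one_smul] at this
  · intro t ht
    have hp := projIcc_of_mem zero_le_one (hmap (Ioo_subset_Icc_self ht))
    refine mem_openQuadrant_iff.2 ⟨hin hentry _ ?_, hout _ ?_⟩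
    · rw [hp]
      exact mul_pos (inv_pos.2 hτ) ht.1
    · rw [hp]
      change (τ z)⁻¹ * t < 1
      rw [inv_mul_lt_iff₀ hτ, mul_one]
      exact ht.2

theorem exists_isTransitMap {k : Fin 4} {f g : Phase m → Phase m} (hf : ContDiff ℝ ∞ f)
    (hg : ContDiff ℝ ∞ g) {γ : ℝ → Phase m} {T : ℝ} {p q : Phase m} (harc : IsArc k f γ T p q)
    {U : Set (Phase m)} (hU : IsOpen U) (hmem : ∀ t ∈ Icc 0 T, γ t ∈ U) {K : Phase m → Level m}
    (hK : ContDiffOn ℝ ∞ K U) (hint : ∀ x ∈ U ∩ openQuadrant k, fderiv ℝ K x (f x) = 0)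
    (hp : ∀ w, entryFunctional k w = 0 → fderiv ℝ K p w = 0 → w = 0)
    (hq : ∀ w, exitFunctional k w = 0 → fderiv ℝ K q w = 0 → w = 0) :
    ∃ Q, IsTransitMap k f g K γ T p q Q := by
  obtain rfl := harc.start_eq
  obtain rfl := harc.end_eq
  have hT := harc.pos
  have hf1 : ContDiff ℝ 1 f := hf.of_le (by simp)
  have hK1 : ContDiffOn ℝ 1 K U := hK.of_le (by simp)
  have hint' : ∀ t ∈ Ioo 0 T, fderiv ℝ K (γ t) (f (γ t)) = 0 := fun t ht =>
    hint _ ⟨hmem t (Ioo_subset_Icc_self ht), harc.interior t ht⟩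
  have hin := pos_velocity_of_first_integral hf1 hT harc.ode hU hK1
    (hmem 0 (left_mem_Icc.2 hT.le)) hint' (mem_switching_iff.1 harc.start_mem).1 harc.entry_pos hp
  have hout := neg_velocity_of_first_integral hf1 hT harc.ode hU hK1
    (hmem T (right_mem_Icc.2 hT.le)) hint' (mem_switching_succ_iff.1 harc.end_mem).1
    harc.exit_pos hq
  obtain ⟨τ, Ψ, h⟩ := exists_isTransit hf hg hT harc.ode harc.entry_pos harc.exit_pos
    (mem_switching_succ_iff.1 harc.end_mem).1 hin hout
  refine ⟨fun z => Ψ z 1, ?_, ?_, h.exit_eq, ?_, ?_⟩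
  · exact ((ContinuousMap.evalCLM ℝ (1 : UnitTime) :
      C(UnitTime, Phase m) →L[ℝ] Phase m).contDiff.contDiffAt).comp _ h.contDiffAt_curve
  · simp [h.curve_eq]
  · intro δ hδ
    filter_upwards [h.isArc, h.eventually_mem hT.le (Metric.isOpen_thickening (δ := δ))
      (fun t ht => Metric.self_subset_thickening hδ _ (mem_image_of_mem γ ht))] with z hz hth hsw
    refine ⟨_, _, hz hsw, ?_⟩
    rintro _ ⟨t, _, rfl⟩
    exact hth _
  · obtain ⟨I, hI, hinc⟩ := h.exists_increment hT.le hg.continuous hU hmem hK1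
      (fun x hxU hi ho => hint x ⟨hxU, mem_openQuadrant_iff.2 ⟨hi, ho⟩⟩)
    refine ⟨I, hI, ?_⟩
    filter_upwards [hinc] with z hz hsw using hz (mem_switching_iff.1 hsw).1

end Arcs

/-! ### First order variation of the transit maps and of the return map. -/

section Return

variable {m : ℕ}

section Jacobian

/-- The deleted column is the one multiplied by the vanishing coordinate of w. -/
theorem submatrix_jacobian_mulVec (K : Phase m → Level m) (x : Phase m) (j : Fin (m + 2))
    {w : Phase m} (hw : w j = 0) :
    ((jacobian K x).submatrix id (Fin.succAbove j)).mulVec (fun i => w (j.succAbove i))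
      = fderiv ℝ K x w := by
  have h1 : (jacobian K x).mulVec w = fderiv ℝ K x w := by
    rw [jacobian, LinearMap.toMatrix'_mulVec]
    rfl
  rw [← h1]
  ext i
  simp only [Matrix.mulVec, dotProduct, Matrix.submatrix_apply, id_eq]
  rw [Fin.sum_univ_succAbove _ j, hw, mul_zero, zero_add]

theorem jacOver_mulVec (K : Phase m → Level m) (x : Phase m) {w : Phase m} (hw : w 0 = 0) :
    (jacOver K x).mulVec (fun i => w (Fin.succAbove 0 i)) = fderiv ℝ K x w :=
  submatrix_jacobian_mulVec K x 0 hw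

theorem jacUnder_mulVec (K : Phase m → Level m) (x : Phase m) {w : Phase m} (hw : w 1 = 0) :
    (jacUnder K x).mulVec (fun i => w (Fin.succAbove 1 i)) = fderiv ℝ K x w :=
  submatrix_jacobian_mulVec K x 1 hw

/-- The form in which (A3) is used: the derivative of the first integral is injective on the
switching hyperplane. -/
theorem eq_zero_of_submatrix_jacobian {K : Phase m → Level m} {x : Phase m} {j : Fin (m + 2)}
    (hdet : ((jacobian K x).submatrix id (Fin.succAbove j)).det ≠ 0) {w : Phase m} (hw : w j = 0)
    (h : fderiv ℝ K x w = 0) : w = 0 := by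
  rw [← submatrix_jacobian_mulVec K x j hw] at h
  have h1 := Matrix.eq_zero_of_mulVec_eq_zero hdet h
  ext i
  rcases Fin.eq_self_or_eq_succAbove j i with rfl | ⟨i', rfl⟩
  · exact hw
  · exact congrFun h1 i'

theorem eq_inv_mulVec {n : Type*} [Fintype n] [DecidableEq n] {M : Matrix n n ℝ}
    (hM : M.det ≠ 0) {x y : n → ℝ} (h : M.mulVec x = y) : x = M⁻¹.mulVec y := by
  rw [← h, Matrix.mulVec_mulVec, Matrix.nonsing_inv_mul _ (isUnit_iff_ne_zero.2 hM),
    Matrix.one_mulVec]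

end Jacobian

/-- Convergence of J suffices because the difference quotient at 0 is J itself. Hence increments of
first integrals need only a limit, not a derivative, of the averaged integral. -/
theorem hasDerivAt_smul_of_tendsto {F : Type*} [NormedAddCommGroup F] [NormedSpace ℝ F]
    {J : ℝ → F} {L : F} (hJ : Tendsto J (𝓝 0) (𝓝 L)) : HasDerivAt (fun ε : ℝ => ε • J ε) L 0 := by
  rw [hasDerivAt_iff_tendsto_slope_zero]
  refine (hJ.mono_left nhdsWithin_le_nhds).congr' ?_
  filter_upwards [self_mem_nhdsWithin] with ε hε
  have hε' : ε ≠ 0 := hε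
  simp [smul_smul, inv_mul_cancel₀ hε']

namespace IsTransitMap

variable {k : Fin 4} {f g : Phase m → Phase m} {K : Phase m → Level m}
  {γ : ℝ → Phase m} {T : ℝ} {p q : Phase m} {Q : Phase m × ℝ → Phase m}

theorem tendsto (h : IsTransitMap k f g K γ T p q Q) :
    Tendsto (fun z => (Q z, z.2)) (𝓝 (p, 0)) (𝓝 (q, 0)) := by
  have h1 : Tendsto Q (𝓝 (p, 0)) (𝓝 q) := by
    have := h.contDiffAt.continuousAt.tendsto
    rwa [h.map_eq] at this
  exact h1.prodMk_nhds continuousAt_snd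

theorem contDiffAt_prodMk (h : IsTransitMap k f g K γ T p q Q) :
    ContDiffAt ℝ ∞ (fun z => (Q z, z.2)) (p, 0) :=
  h.contDiffAt.prodMk contDiffAt_snd

/-- The transit map along a curve of initial points. -/
theorem exists_hasDerivAt (h : IsTransitMap k f g K γ T p q Q) {x : ℝ → Phase m} {x' : Phase m}
    (hx : HasDerivAt x x' 0) (hx0 : x 0 = p) (hsw : ∀ᶠ ε in 𝓝 (0 : ℝ), x ε ∈ switching k)
    (hKp : DifferentiableAt ℝ K p) (hKq : DifferentiableAt ℝ K q) :
    Q (x 0, 0) = q ∧ (∀ᶠ ε in 𝓝 (0 : ℝ), Q (x ε, ε) ∈ switching (k + 1)) ∧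
    ∃ y', HasDerivAt (fun ε => Q (x ε, ε)) y' 0 ∧ exitFunctional k y' = 0 ∧
      fderiv ℝ K q y' = fderiv ℝ K p x' + arcIntegral K g γ T := by
  subst hx0
  have hz : HasDerivAt (fun ε : ℝ => (x ε, ε)) (x', (1 : ℝ)) 0 := hx.prodMk (hasDerivAt_id 0)
  have hzt : Tendsto (fun ε : ℝ => (x ε, ε)) (𝓝 0) (𝓝 (x 0, 0)) := hz.continuousAt.tendsto
  have hQ : HasDerivAt (fun ε : ℝ => Q (x ε, ε)) _ 0 :=
    HasFDerivAt.comp_hasDerivAt (f := fun ε : ℝ => (x ε, ε)) 0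
      (h.contDiffAt.differentiableAt (by simp)).hasFDerivAt hz
  refine ⟨h.map_eq, ?_, _, hQ, ?_, ?_⟩
  · filter_upwards [hzt.eventually (h.arc 1 one_pos), hsw] with ε hε hs
    obtain ⟨c, τ, harc, _⟩ := hε hs
    exact harc.end_mem
  · have h1 := (exitFunctional k).hasFDerivAt.comp_hasDerivAt 0 hQ
    refine h1.unique ((hasDerivAt_const (0 : ℝ) (0 : ℝ)).congr_of_eventuallyEq ?_)
    filter_upwards [hzt.eventually h.exit_eq] with ε hε using hε
  · obtain ⟨I, hI, hinc⟩ := h.increment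
    have h1 := hKp.hasFDerivAt.comp_hasDerivAt 0 hx
    have h2 : HasDerivAt (fun ε : ℝ => K (Q (x ε, ε))) _ 0 :=
      HasFDerivAt.comp_hasDerivAt (f := fun ε : ℝ => Q (x ε, ε)) 0
        (by rw [h.map_eq]; exact hKq.hasFDerivAt) hQ
    have h3 := hasDerivAt_smul_of_tendsto (hI.comp hzt)
    have h4 := h3.add h1
    refine (h2.unique (h4.congr_of_eventuallyEq ?_)).trans (add_comm _ _)
    filter_upwards [hzt.eventually hinc, hsw] with ε hε hs
    have := hε hs
    simp only [Pi.add_apply, Function.comp_apply]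
    rw [← this]
    abel

end IsTransitMap

section ReturnMap

variable {f g : Fin 4 → Phase m → Phase m} {H : Fin 4 → Phase m → Level m}
  {γ : Fin 4 → ℝ → Phase m} {T : Fin 4 → ℝ} {a b c e : Phase m}
  {Q : Fin 4 → Phase m × ℝ → Phase m}

/-- A return of `p` to `q` along four arcs contained in `S`. -/
def IsReturnWithin (v : Fin 4 → Phase m → Phase m) (S : Set (Phase m)) (p q : Phase m) : Prop :=
  ∃ (x : Fin 4 → Phase m) (α : Fin 4 → ℝ → Phase m) (τ : Fin 4 → ℝ), x 0 = p ∧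
    IsArc 0 (v 0) (α 0) (τ 0) (x 0) (x 1) ∧ IsArc 1 (v 1) (α 1) (τ 1) (x 1) (x 2) ∧
    IsArc 2 (v 2) (α 2) (τ 2) (x 2) (x 3) ∧ IsArc 3 (v 3) (α 3) (τ 3) (x 3) q ∧
    ∀ k, α k '' Icc 0 (τ k) ⊆ S

theorem IsReturnWithin.isReturn {v : Fin 4 → Phase m → Phase m} {S : Set (Phase m)}
    {p q : Phase m} (h : IsReturnWithin v S p q) : IsReturn v p q := by
  obtain ⟨x, α, τ, rfl, h0, h1, h2, h3, -⟩ := h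
  exact ⟨x 1, x 2, x 3, ⟨_, _, h0⟩, ⟨_, _, h1⟩, ⟨_, _, h2⟩, ⟨_, _, h3⟩⟩

/-- The composition of the four transit maps. -/
def returnMap (Q : Fin 4 → Phase m × ℝ → Phase m) (z : Phase m × ℝ) : Phase m :=
  Q 3 (Q 2 (Q 1 (Q 0 z, z.2), z.2), z.2)

theorem returnMap_eq
    (h0 : IsTransitMap 0 (f 0) (g 0) (H 0) (γ 0) (T 0) a b (Q 0))
    (h1 : IsTransitMap 1 (f 1) (g 1) (H 1) (γ 1) (T 1) b c (Q 1))
    (h2 : IsTransitMap 2 (f 2) (g 2) (H 2) (γ 2) (T 2) c e (Q 2))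
    (h3 : IsTransitMap 3 (f 3) (g 3) (H 3) (γ 3) (T 3) e a (Q 3)) :
    returnMap Q (a, 0) = a := by
  simp [returnMap, h0.map_eq, h1.map_eq, h2.map_eq, h3.map_eq]

theorem contDiffAt_returnMap
    (h0 : IsTransitMap 0 (f 0) (g 0) (H 0) (γ 0) (T 0) a b (Q 0))
    (h1 : IsTransitMap 1 (f 1) (g 1) (H 1) (γ 1) (T 1) b c (Q 1))
    (h2 : IsTransitMap 2 (f 2) (g 2) (H 2) (γ 2) (T 2) c e (Q 2))
    (h3 : IsTransitMap 3 (f 3) (g 3) (H 3) (γ 3) (T 3) e a (Q 3)) :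
    ContDiffAt ℝ ∞ (returnMap Q) (a, 0) := by
  have k1 : ContDiffAt ℝ ∞ (fun z => (Q 1 z, z.2)) (Q 0 (a, 0), (0 : ℝ)) :=
    h0.map_eq.symm ▸ h1.contDiffAt_prodMk
  have k01 := ContDiffAt.comp (g := fun z => (Q 1 z, z.2)) (a, (0 : ℝ)) k1 h0.contDiffAt_prodMk
  have k2 : ContDiffAt ℝ ∞ (fun z => (Q 2 z, z.2)) (Q 1 (Q 0 (a, 0), 0), (0 : ℝ)) := by
    rw [h0.map_eq, h1.map_eq]
    exact h2.contDiffAt_prodMk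
  have k012 := ContDiffAt.comp (g := fun z => (Q 2 z, z.2)) (a, (0 : ℝ)) k2 k01
  have k3 : ContDiffAt ℝ ∞ (Q 3) (Q 2 (Q 1 (Q 0 (a, 0), 0), 0), (0 : ℝ)) := by
    rw [h0.map_eq, h1.map_eq, h2.map_eq]
    exact h3.contDiffAt
  exact ContDiffAt.comp (g := Q 3) (a, (0 : ℝ)) k3 k012

theorem eventually_isReturnWithin
    (h0 : IsTransitMap 0 (f 0) (g 0) (H 0) (γ 0) (T 0) a b (Q 0))
    (h1 : IsTransitMap 1 (f 1) (g 1) (H 1) (γ 1) (T 1) b c (Q 1))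
    (h2 : IsTransitMap 2 (f 2) (g 2) (H 2) (γ 2) (T 2) c e (Q 2))
    (h3 : IsTransitMap 3 (f 3) (g 3) (H 3) (γ 3) (T 3) e a (Q 3))
    {δ : ℝ} (hδ : 0 < δ) :
    ∀ᶠ z in 𝓝 (a, (0 : ℝ)), z.1 ∈ switching 0 →
      IsReturnWithin (perturbed f g z.2) (Metric.thickening δ (⋃ k, γ k '' Icc 0 (T k))) z.1
        (returnMap Q z) := by
  have t1 := h0.tendsto
  have t2 := h1.tendsto.comp t1
  have t3 := h2.tendsto.comp t2
  filter_upwards [h0.arc δ hδ, t1.eventually (h1.arc δ hδ), t2.eventually (h2.arc δ hδ),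
    t3.eventually (h3.arc δ hδ)] with z e0 e1 e2 e3 hz
  obtain ⟨α0, τ0, a0, s0⟩ := e0 hz
  obtain ⟨α1, τ1, a1, s1⟩ := e1 a0.end_mem
  obtain ⟨α2, τ2, a2, s2⟩ := e2 a1.end_mem
  obtain ⟨α3, τ3, a3, s3⟩ := e3 a2.end_mem
  refine ⟨![z.1, Q 0 z, Q 1 (Q 0 z, z.2), Q 2 (Q 1 (Q 0 z, z.2), z.2)], ![α0, α1, α2, α3],
    ![τ0, τ1, τ2, τ3], rfl, a0, a1, a2, a3, fun k => ?_⟩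
  have hsub : ∀ k, Metric.thickening δ (γ k '' Icc 0 (T k)) ⊆
      Metric.thickening δ (⋃ k, γ k '' Icc 0 (T k)) := fun k =>
    Metric.thickening_subset_of_subset δ (subset_iUnion (fun k => γ k '' Icc 0 (T k)) k)
  fin_cases k
  · exact s0.trans (hsub 0)
  · exact s1.trans (hsub 1)
  · exact s2.trans (hsub 2)
  · exact s3.trans (hsub 3)

/-- The derivative of the return map along a curve of initial points which compensates the
increment of the first integral on the first arc. -/
theorem exists_hasDerivAt_returnMap
    (h0 : IsTransitMap 0 (f 0) (g 0) (H 0) (γ 0) (T 0) a b (Q 0))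
    (h1 : IsTransitMap 1 (f 1) (g 1) (H 1) (γ 1) (T 1) b c (Q 1))
    (h2 : IsTransitMap 2 (f 2) (g 2) (H 2) (γ 2) (T 2) c e (Q 2))
    (h3 : IsTransitMap 3 (f 3) (g 3) (H 3) (γ 3) (T 3) e a (Q 3))
    {U : Set (Phase m)} (hU : IsOpen U)
    (hH : ∀ k, ContDiffOn ℝ ∞ (H k) U) (ha : a ∈ U) (hb : b ∈ U) (hc : c ∈ U) (he : e ∈ U)
    (hA : (jacOver (H 3) a).det ≠ 0) (hB : (jacUnder (H 0) b).det ≠ 0)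
    (hC : (jacOver (H 1) c).det ≠ 0) (hE : (jacUnder (H 2) e).det ≠ 0)
    {x : ℝ → Phase m} {x' : Phase m} (hx : HasDerivAt x x' 0) (hx0 : x 0 = a)
    (hsw : ∀ᶠ ε in 𝓝 (0 : ℝ), x ε ∈ switching 0)
    (hx' : fderiv ℝ (H 0) a x' = -arcIntegral (H 0) (g 0) (γ 0) (T 0)) :
    ∃ y', HasDerivAt (fun ε => returnMap Q (x ε, ε)) y' 0 ∧ fderiv ℝ (H 0) a y' =
      (jacOver (H 0) a * (jacOver (H 3) a)⁻¹ * jacUnder (H 3) e * (jacUnder (H 2) e)⁻¹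
        * jacOver (H 2) c * (jacOver (H 1) c)⁻¹).mulVec (arcIntegral (H 1) (g 1) (γ 1) (T 1))
      + (jacOver (H 0) a * (jacOver (H 3) a)⁻¹ * jacUnder (H 3) e
        * (jacUnder (H 2) e)⁻¹).mulVec (arcIntegral (H 2) (g 2) (γ 2) (T 2))
      + (jacOver (H 0) a * (jacOver (H 3) a)⁻¹).mulVec
        (arcIntegral (H 3) (g 3) (γ 3) (T 3)) := by
  have hd : ∀ k, ∀ y ∈ U, DifferentiableAt ℝ (H k) y := fun k y hy =>
    ((hH k).differentiableOn (by simp)).differentiableAt (hU.mem_nhds hy)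
  obtain ⟨x1, w1, y1, d1, e1, i1⟩ := h0.exists_hasDerivAt hx hx0 hsw (hd 0 a ha) (hd 0 b hb)
  obtain ⟨x2, w2, y2, d2, e2, i2⟩ := h1.exists_hasDerivAt d1 x1 w1 (hd 1 b hb) (hd 1 c hc)
  obtain ⟨x3, w3, y3, d3, e3, i3⟩ := h2.exists_hasDerivAt d2 x2 w2 (hd 2 c hc) (hd 2 e he)
  obtain ⟨x4, w4, y4, d4, e4, i4⟩ := h3.exists_hasDerivAt d3 x3 w3 (hd 3 e he) (hd 3 a ha)
  refine ⟨y4, d4, ?_⟩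
  have z1 : y1 1 = 0 := e1
  have z2 : y2 0 = 0 := e2
  have z3 : y3 1 = 0 := by simpa [exitFunctional] using e3
  have z4 : y4 0 = 0 := by simpa [exitFunctional] using e4
  rw [hx', neg_add_cancel] at i1
  -- The variation x' cancels the first arc's integral, so the point on Σ_B is stationary to first
  -- order and no minor at B enters the result.
  obtain rfl : y1 = 0 := eq_zero_of_submatrix_jacobian hB z1 i1
  rw [map_zero, zero_add, ← jacOver_mulVec _ _ z2] at i2
  rw [← jacUnder_mulVec _ _ z3, ← jacOver_mulVec _ _ z2] at i3
  rw [← jacOver_mulVec _ _ z4, ← jacUnder_mulVec _ _ z3] at i4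
  have j2 := eq_inv_mulVec hC i2
  have j3 := eq_inv_mulVec hE i3
  have j4 := eq_inv_mulVec hA i4
  rw [← jacOver_mulVec _ _ z4, j4, j3, j2]
  simp only [Matrix.mulVec_add, Matrix.mulVec_mulVec, Matrix.mul_assoc]

end ReturnMap

end Return

/-! ### The unperturbed family and the return map in the coordinate h. -/

section Family

variable {m : ℕ} {f g : Fin 4 → Phase m → Phase m} {U : Set (Phase m)}
  {H : Fin 4 → Phase m → Level m} {G : Set (Level m)} {A B C E : Level m → Phase m}
  {T : Fin 4 → Level m → ℝ} {γ : Fin 4 → Level m → ℝ → Phase m} {h : Level m}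

theorem contDiff_perturbed (hf : ∀ k, ContDiff ℝ ∞ (f k)) (hg : ∀ k, ContDiff ℝ ∞ (g k)) (ε : ℝ)
    (k : Fin 4) : ContDiff ℝ 1 (perturbed f g ε k) :=
  ((hf k).add ((hg k).const_smul ε)).of_le (by simp)

theorem levelCurve_subset (k : Fin 4) : levelCurve U H B C E h k ⊆ U := by
  intro x hx
  fin_cases k <;> exact hx.1.1

namespace AssumptionA2

/-- Interior points belong to a level curve, which is a subset of U by definition. The end points
are treated separately because only the first region contains them. -/
theorem arc_mem (hA2 : AssumptionA2 f U H G A B C E T γ) (hh : h ∈ G)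
    {k : Fin 4} {p q : Phase m} (harc : IsArc k (f k) (γ k h) (T k h) p q)
    (hp : p ∈ U) (hq : q ∈ U) : ∀ t ∈ Icc 0 (T k h), γ k h t ∈ U := by
  intro t ht
  rcases eq_or_lt_of_le ht.1 with rfl | h0
  · rwa [harc.start_eq]
  rcases eq_or_lt_of_le ht.2 with rfl | h1
  · rwa [harc.end_eq]
  refine levelCurve_subset (H := H) (B := B) (C := C) (E := E) (h := h) k ?_
  rw [hA2.level_eq h hh k]
  exact ⟨mem_image_of_mem _ ht, openQuadrant_subset_region k (harc.interior t ⟨h0, h1⟩)⟩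

theorem A_mem_switching (hA2 : AssumptionA2 f U H G A B C E T γ) (hh : h ∈ G) :
    A h ∈ switching 0 := (hA2.arc_AB h hh).start_mem

theorem first_integral_A (hA2 : AssumptionA2 f U H G A B C E T γ) (hh : h ∈ G) :
    H 0 (A h) = h := by
  have harc := hA2.arc_AB h hh
  have hsw : A h 0 = 0 ∧ 0 < A h 1 := harc.start_mem
  have : A h ∈ levelCurve U H B C E h 0 := by
    rw [hA2.level_eq h hh 0]
    exact ⟨⟨0, left_mem_Icc.2 harc.pos.le, harc.start_eq⟩, hsw.1.ge, hsw.2.le⟩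
  exact this.2

/-- The level curve in the closed first region is exactly the arc from A to B, which meets x₁ = 0
only at its start. This makes H¹ a faithful coordinate on Σ_A. -/
theorem eq_A (hA2 : AssumptionA2 f U H G A B C E T γ) (hh : h ∈ G)
    {p : Phase m} (hp : p ∈ switching 0) (hpU : p ∈ U) (hpG : H 0 p = h) : p = A h := by
  have harc := hA2.arc_AB h hh
  have hsw : p 0 = 0 ∧ 0 < p 1 := hp
  have h1 : p ∈ levelCurve U H B C E h 0 := ⟨⟨hpU, hsw.1.ge, hsw.2.le⟩, hpG⟩
  rw [hA2.level_eq h hh 0] at h1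
  obtain ⟨⟨t, ht, rfl⟩, -⟩ := h1
  rcases eq_or_lt_of_le ht.1 with rfl | h0
  · exact harc.start_eq
  · exact absurd hsw.1 (harc.entry_pos t ⟨h0, ht.2⟩).ne'

theorem isReturn (hA2 : AssumptionA2 f U H G A B C E T γ) (hh : h ∈ G) :
    IsReturn f (A h) (A h) :=
  ⟨B h, C h, E h, ⟨_, _, hA2.arc_AB h hh⟩, ⟨_, _, hA2.arc_BC h hh⟩, ⟨_, _, hA2.arc_CE h hh⟩,
    ⟨_, _, hA2.arc_EA h hh⟩⟩

end AssumptionA2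

theorem exists_isTransitMap_family (hf : ∀ k, ContDiff ℝ ∞ (f k)) (hg : ∀ k, ContDiff ℝ ∞ (g k))
    (hA1 : AssumptionA1 f U H) (hA2 : AssumptionA2 f U H G A B C E T γ)
    (hA3 : AssumptionA3 H G A B C E) (hh : h ∈ G) :
    ∃ Q : Fin 4 → Phase m × ℝ → Phase m,
      IsTransitMap 0 (f 0) (g 0) (H 0) (γ 0 h) (T 0 h) (A h) (B h) (Q 0) ∧
      IsTransitMap 1 (f 1) (g 1) (H 1) (γ 1 h) (T 1 h) (B h) (C h) (Q 1) ∧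
      IsTransitMap 2 (f 2) (g 2) (H 2) (γ 2 h) (T 2 h) (C h) (E h) (Q 2) ∧
      IsTransitMap 3 (f 3) (g 3) (H 3) (γ 3 h) (T 3 h) (E h) (A h) (Q 3) := by
  obtain ⟨hA, hB, hC, hE⟩ := hA2.mem h hh
  have hint : ∀ k, ∀ x ∈ U ∩ openQuadrant k, fderiv ℝ (H k) x (f k x) = 0 := fun k x hx =>
    hA1.first_integral k x ⟨hx.1, openQuadrant_subset_region k hx.2⟩
  have ker : ∀ {K : Phase m → Level m} {x : Phase m} {j : Fin (m + 2)} {ℓ : Phase m →L[ℝ] ℝ},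
      ((jacobian K x).submatrix id (Fin.succAbove j)).det ≠ 0 → (∀ w, ℓ w = 0 → w j = 0) →
      ∀ w, ℓ w = 0 → fderiv ℝ K x w = 0 → w = 0 := fun hdet hℓ w hw hz =>
    eq_zero_of_submatrix_jacobian hdet (hℓ w hw) hz
  obtain ⟨Q0, h0⟩ := exists_isTransitMap (hf 0) (hg 0) (hA2.arc_AB h hh) hA1.isOpen
    (hA2.arc_mem hh (hA2.arc_AB h hh) hA hB) (hA1.smooth 0) (hint 0)
    (ker (hA3.at_A h hh).2 fun w hw => by simpa [entryFunctional] using hw)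
    (ker (hA3.at_B h hh).1 fun w hw => by simpa [exitFunctional] using hw)
  obtain ⟨Q1, h1⟩ := exists_isTransitMap (hf 1) (hg 1) (hA2.arc_BC h hh) hA1.isOpen
    (hA2.arc_mem hh (hA2.arc_BC h hh) hB hC) (hA1.smooth 1) (hint 1)
    (ker (hA3.at_B h hh).2 fun w hw => by simpa [entryFunctional] using hw)
    (ker (hA3.at_C h hh).1 fun w hw => by simpa [exitFunctional] using hw)
  obtain ⟨Q2, h2⟩ := exists_isTransitMap (hf 2) (hg 2) (hA2.arc_CE h hh) hA1.isOpen
    (hA2.arc_mem hh (hA2.arc_CE h hh) hC hE) (hA1.smooth 2) (hint 2)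
    (ker (hA3.at_C h hh).2 fun w hw => by simpa [entryFunctional] using hw)
    (ker (hA3.at_E h hh).1 fun w hw => by simpa [exitFunctional] using hw)
  obtain ⟨Q3, h3⟩ := exists_isTransitMap (hf 3) (hg 3) (hA2.arc_EA h hh) hA1.isOpen
    (hA2.arc_mem hh (hA2.arc_EA h hh) hE hA) (hA1.smooth 3) (hint 3)
    (ker (hA3.at_E h hh).2 fun w hw => by simpa [entryFunctional] using hw)
    (ker (hA3.at_A h hh).1 fun w hw => by simpa [exitFunctional] using hw)
  exact ⟨![Q0, Q1, Q2, Q3], h0, h1, h2, h3⟩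

/-- The parametrization of the hyperplane `x₁ = 0` by the other coordinates. -/
def hyperplaneInclusion : Level m →L[ℝ] Phase m :=
  ContinuousLinearMap.pi (Fin.cons 0 fun j => ContinuousLinearMap.proj j)

theorem hyperplaneInclusion_zero (y : Level m) : hyperplaneInclusion y 0 = 0 := rfl

/-- The point `A(h)` depends smoothly on `h`. -/
theorem contDiffAt_A (hA1 : AssumptionA1 f U H) (hA2 : AssumptionA2 f U H G A B C E T γ)
    (hA3 : AssumptionA3 H G A B C E) (hh : h ∈ G) : ContDiffAt ℝ ∞ A h := by
  have hAU := (hA2.mem h hh).1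
  have hsw : A h 0 = 0 ∧ 0 < A h 1 := hA2.A_mem_switching hh
  let ι : Level m →L[ℝ] Phase m := hyperplaneInclusion
  let y₀ : Level m := fun i => A h i.succ
  have hy₀ : ι y₀ = A h := by
    ext i
    refine Fin.cases ?_ (fun j => ?_) i
    · exact hsw.1.symm
    · rfl
  have hH0 : ContDiffAt ℝ ∞ (H 0) (ι y₀) := by
    rw [hy₀]
    exact (hA1.smooth 0).contDiffAt (hA1.isOpen.mem_nhds hAU)
  let θ : Level m → Level m := fun y => H 0 (ι y)
  have hθ : ContDiffAt ℝ ∞ θ y₀ := ContDiffAt.comp y₀ hH0 ι.contDiff.contDiffAt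
  have hθ₀ : θ y₀ = h := by
    change H 0 (ι y₀) = h
    rw [hy₀, hA2.first_integral_A hh]
  let L : Level m →L[ℝ] Level m := fderiv ℝ (H 0) (A h) ∘L ι
  have hL : HasFDerivAt θ L y₀ := by
    have h1 := (hH0.differentiableAt (by simp)).hasFDerivAt
    rw [hy₀] at h1
    exact HasFDerivAt.comp y₀ (by rw [hy₀]; exact h1) ι.hasFDerivAt
  have hinj : Function.Injective L := by
    rw [injective_iff_map_eq_zero]
    intro y hy
    -- Invertibility of the minor at A lets the inverse function theorem solve H¹ = h' on x₁ = 0; by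
    -- `eq_A` the solution is A(h').
    have h1 := eq_zero_of_submatrix_jacobian (j := 0) (hA3.at_A h hh).2
      (hyperplaneInclusion_zero y) hy
    ext i
    exact congrFun h1 i.succ
  let e : Level m ≃L[ℝ] Level m :=
    (LinearEquiv.ofInjectiveEndo (L : Level m →ₗ[ℝ] Level m) hinj).toContinuousLinearEquiv
  have he : HasFDerivAt θ (e : Level m →L[ℝ] Level m) y₀ := by
    convert hL using 1
    ext1 y
    rfl
  let φ : Level m → Level m := hθ.localInverse he (by simp)
  have hφ : ContDiffAt ℝ ∞ φ h := by
    have := hθ.to_localInverse he (by simp)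
    rwa [hθ₀] at this
  have hφ₀ : φ h = y₀ := by
    have := hθ.localInverse_apply_image he (by simp)
    rwa [hθ₀] at this
  have hright : ∀ᶠ h' in 𝓝 h, θ (φ h') = h' := by
    have := (hθ.hasStrictFDerivAt' he (by simp)).eventually_right_inverse
    rwa [hθ₀] at this
  have hcomp : ContDiffAt ℝ ∞ (fun h' => ι (φ h')) h := ι.contDiff.contDiffAt.comp h hφ
  have ht : Tendsto (fun h' => ι (φ h')) (𝓝 h) (𝓝 (A h)) := by
    have := hcomp.continuousAt.tendsto
    rwa [hφ₀, hy₀] at this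
  refine hcomp.congr_of_eventuallyEq ?_
  have hpos : ∀ᶠ x : Phase m in 𝓝 (A h), 0 < x 1 :=
    (continuous_apply 1).continuousAt.eventually_const_lt hsw.2
  filter_upwards [hright, hA2.isOpen.mem_nhds hh, ht.eventually (hA1.isOpen.mem_nhds hAU),
    ht.eventually hpos] with h' h1 h2 h3 h4
  exact (hA2.eq_A h2 (show ι (φ h') ∈ switching 0 from ⟨rfl, h4⟩) h3 h1).symm

/-- The local structure of the displacement map near the parameter `h`. -/
theorem exists_local_return (hf : ∀ k, ContDiff ℝ ∞ (f k)) (hg : ∀ k, ContDiff ℝ ∞ (g k))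
    (hA1 : AssumptionA1 f U H) (hA2 : AssumptionA2 f U H G A B C E T γ)
    (hA3 : AssumptionA3 H G A B C E) (hh : h ∈ G) :
    ∃ R : Level m × ℝ → Level m, ContDiffAt ℝ ∞ R (h, 0) ∧
      (∀ᶠ w in 𝓝 (h, (0 : ℝ)), displacement f g H A w.1 w.2 = R w - w.1) ∧
      (∀ᶠ h' in 𝓝 h, R (h', 0) = h') ∧
      fderiv ℝ R (h, 0) (0, 1) = melnikovFormula g H A C E T γ h ∧
      ∀ δ > 0, ∀ᶠ w in 𝓝 (h, (0 : ℝ)), ∃ q ∈ U, H 0 q = R w ∧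
        IsReturnWithin (perturbed f g w.2) (Metric.thickening δ (orbit T γ h)) (A w.1) q := by
  obtain ⟨Q, h0, h1, h2, h3⟩ := exists_isTransitMap_family hf hg hA1 hA2 hA3 hh
  obtain ⟨hAU, hBU, hCU, hEU⟩ := hA2.mem h hh
  have hA := contDiffAt_A hA1 hA2 hA3 hh
  have hQ := contDiffAt_returnMap (γ := fun k => γ k h) (T := fun k => T k h) h0 h1 h2 h3
  have hQ₀ := returnMap_eq (γ := fun k => γ k h) (T := fun k => T k h) h0 h1 h2 h3
  have hz : ContDiffAt ℝ ∞ (fun w : Level m × ℝ => (A w.1, w.2)) (h, 0) :=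
    (ContDiffAt.comp (f := Prod.fst) (h, (0 : ℝ)) hA contDiffAt_fst).prodMk contDiffAt_snd
  have hzt : Tendsto (fun w : Level m × ℝ => (A w.1, w.2)) (𝓝 (h, 0)) (𝓝 (A h, 0)) :=
    hz.continuousAt.tendsto
  have hP : ContDiffAt ℝ ∞ (fun w : Level m × ℝ => returnMap Q (A w.1, w.2)) (h, 0) :=
    ContDiffAt.comp (g := returnMap Q) (h, (0 : ℝ)) hQ hz
  have hPt : Tendsto (fun w : Level m × ℝ => returnMap Q (A w.1, w.2)) (𝓝 (h, 0)) (𝓝 (A h)) := by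
    have := hP.continuousAt.tendsto
    rwa [hQ₀] at this
  have hHA : ContDiffAt ℝ ∞ (H 0) (A h) :=
    (hA1.smooth 0).contDiffAt (hA1.isOpen.mem_nhds hAU)
  have hG : ∀ᶠ w in 𝓝 (h, (0 : ℝ)), w.1 ∈ G :=
    continuousAt_fst.eventually (hA2.isOpen.mem_nhds hh)
  have hret : ∀ δ > 0, ∀ᶠ w in 𝓝 (h, (0 : ℝ)), IsReturnWithin (perturbed f g w.2)
      (Metric.thickening δ (orbit T γ h)) (A w.1) (returnMap Q (A w.1, w.2)) := by
    intro δ hδ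
    filter_upwards [hzt.eventually (eventually_isReturnWithin (γ := fun k => γ k h)
      (T := fun k => T k h) h0 h1 h2 h3 hδ), hG] with w hw hwG
    exact hw (hA2.A_mem_switching hwG)
  have hR : ContDiffAt ℝ ∞ (fun w : Level m × ℝ => H 0 (returnMap Q (A w.1, w.2))) (h, 0) :=
    ContDiffAt.comp (g := H 0) (f := fun w : Level m × ℝ => returnMap Q (A w.1, w.2)) (h, (0 : ℝ))
      (by rw [hQ₀]; exact hHA) hP
  -- The return built from the transit maps and the one given by the closed orbit coincide by
  -- uniqueness of returns.
  have hid : ∀ᶠ h' in 𝓝 h, H 0 (returnMap Q (A h', 0)) = h' := by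
    have ht : Tendsto (fun h' : Level m => (h', (0 : ℝ))) (𝓝 h) (𝓝 (h, 0)) :=
      (by fun_prop : Continuous fun h' : Level m => (h', (0 : ℝ))).tendsto h
    filter_upwards [ht.eventually (hret 1 one_pos), hA2.isOpen.mem_nhds hh] with h' hr hG'
    have hr' := hr.isReturn
    have hpert : perturbed f g (h', (0 : ℝ)).2 = f := by
      funext k x
      simp [perturbed]
    rw [hpert] at hr'
    rw [hr'.unique (fun k => (hf k).of_le (by simp)) (hA2.isReturn hG'),
      hA2.first_integral_A hG']
  refine ⟨fun w => H 0 (returnMap Q (A w.1, w.2)), hR, ?_, hid, ?_, ?_⟩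
  · filter_upwards [hret 1 one_pos, hG] with w hw hwG
    rw [displacement, returnPoint_eq (contDiff_perturbed hf hg w.2) hw.isReturn,
      hA2.first_integral_A hwG]
  · set I₀ := arcIntegral (H 0) (g 0) (γ 0 h) (T 0 h) with hI₀
    have hRd := (hR.differentiableAt (by simp)).hasFDerivAt
    set D := fderiv ℝ (fun w : Level m × ℝ => H 0 (returnMap Q (A w.1, w.2))) (h, 0) with hD
    have hD1 : ∀ u, D (u, 0) = u := by
      intro u
      have hc : HasFDerivAt (fun h' : Level m => (h', (0 : ℝ)))
          (ContinuousLinearMap.inl ℝ (Level m) ℝ) h := hasFDerivAt_prodMk_left h 0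
      have h4 := (HasFDerivAt.comp (f := fun h' : Level m => (h', (0 : ℝ))) h hRd hc).unique
        ((hasFDerivAt_id h).congr_of_eventuallyEq hid)
      exact congrArg (fun M : Level m →L[ℝ] Level m => M u) h4
    -- Lowering the initial level by ε I₀ compensates the increment of H¹ on the first arc.
    have hl : HasDerivAt (fun ε : ℝ => h - ε • I₀) (-I₀) 0 := by
      simpa using ((hasDerivAt_id (0 : ℝ)).smul_const I₀).const_sub h
    have hl0 : h - (0 : ℝ) • I₀ = h := by simp
    have hlt : Tendsto (fun ε : ℝ => h - ε • I₀) (𝓝 0) (𝓝 h) := by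
      have := hl.continuousAt.tendsto
      rwa [hl0] at this
    have hAd := (hA.differentiableAt (by simp)).hasFDerivAt
    have hx : HasDerivAt (fun ε : ℝ => A (h - ε • I₀)) (fderiv ℝ A h (-I₀)) 0 :=
      HasFDerivAt.comp_hasDerivAt (f := fun ε : ℝ => h - ε • I₀) 0 (by rw [hl0]; exact hAd) hl
    have hx' : fderiv ℝ (H 0) (A h) (fderiv ℝ A h (-I₀)) = -I₀ := by
      have h4 := ((hHA.differentiableAt (by simp)).hasFDerivAt.comp h hAd).unique
        ((hasFDerivAt_id h).congr_of_eventuallyEq (by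
          filter_upwards [hA2.isOpen.mem_nhds hh] with h' hG' using hA2.first_integral_A hG'))
      exact congrArg (fun M : Level m →L[ℝ] Level m => M (-I₀)) h4
    obtain ⟨y', hy', hval⟩ := exists_hasDerivAt_returnMap (γ := fun k => γ k h)
      (T := fun k => T k h) h0 h1 h2 h3 hA1.isOpen hA1.smooth
      hAU hBU hCU hEU (hA3.at_A h hh).1 (hA3.at_B h hh).1 (hA3.at_C h hh).1 (hA3.at_E h hh).1
      hx (by rw [hl0]) (by
        filter_upwards [hlt.eventually (hA2.isOpen.mem_nhds hh)] with ε hε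
          using hA2.A_mem_switching hε) hx'
    have h5 : HasDerivAt (fun ε : ℝ => H 0 (returnMap Q (A (h - ε • I₀), ε)))
        (fderiv ℝ (H 0) (A h) y') 0 :=
      HasFDerivAt.comp_hasDerivAt (f := fun ε : ℝ => returnMap Q (A (h - ε • I₀), ε)) 0
        (by rw [hl0, hQ₀]; exact (hHA.differentiableAt (by simp)).hasFDerivAt) hy'
    have hRd' : HasFDerivAt (fun w : Level m × ℝ => H 0 (returnMap Q (A w.1, w.2))) D
        (h - (0 : ℝ) • I₀, (0 : ℝ)) := by
      rw [hl0]
      exact hRd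
    have h6 : HasDerivAt (fun ε : ℝ => H 0 (returnMap Q (A (h - ε • I₀), ε)))
        (D (-I₀, 1)) 0 :=
      HasFDerivAt.comp_hasDerivAt (f := fun ε : ℝ => (h - ε • I₀, ε)) (0 : ℝ) hRd'
        (hl.prodMk (hasDerivAt_id (0 : ℝ)))
    have h7 := h6.unique h5
    -- The compensation is undone by linearity: D is the identity in the h-direction.
    have h8 : D (0, 1) = I₀ + D (-I₀, 1) := by
      rw [← hD1 I₀, ← map_add, hD1 I₀]
      simp
    rw [h8, h7, hval, melnikovFormula, ← hI₀]
    abel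
  · intro δ hδ
    filter_upwards [hret δ hδ, hPt.eventually (hA1.isOpen.mem_nhds hAU)] with w hw hwU
    exact ⟨_, hwU, rfl, hw⟩

end Family

/-! ### Fixed points of a perturbation of the identity. -/

section Bifurcation

variable {X : Type*} [NormedAddCommGroup X] [NormedSpace ℝ X]

/-- Strict differentiability of ∂R/∂ε bounds its increments in x, minus D, by c ‖x - y‖ at every
small parameter r. The mean value inequality in r from 0 to ε, starting from R(x, 0) = x, yields a
factor |ε| that the division removes. -/
theorem approximatesLinearOn_displacement {R : X × ℝ → X} {x₀ : X} (hR : ContDiffAt ℝ 2 R (x₀, 0))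
    (hid : ∀ᶠ x in 𝓝 x₀, R (x, 0) = x) {D : X →L[ℝ] X}
    (hD : HasFDerivAt (fun x => fderiv ℝ R (x, 0) (0, 1)) D x₀) {c : NNReal} (hc : 0 < c) :
    ∃ ρ > 0, ∀ ε : ℝ, ε ≠ 0 → |ε| < ρ →
      ApproximatesLinearOn (fun x => ε⁻¹ • (R (x, ε) - x)) D (Metric.ball x₀ ρ) c := by
  let P : X × ℝ → X := fun w => fderiv ℝ R w (0, 1)
  have hP : ContDiffAt ℝ 1 P (x₀, 0) :=
    (hR.fderiv_right (m := 1) (by norm_num)).clm_apply contDiffAt_const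
  have hPs : HasStrictFDerivAt P (fderiv ℝ P (x₀, 0)) (x₀, 0) := hP.hasStrictFDerivAt one_ne_zero
  have hPD : ∀ u, fderiv ℝ P (x₀, 0) (u, 0) = D u := by
    intro u
    have h1 : HasFDerivAt (fun x : X => (x, (0 : ℝ))) (ContinuousLinearMap.inl ℝ X ℝ) x₀ :=
      hasFDerivAt_prodMk_left x₀ 0
    have h2 := (HasFDerivAt.comp (f := fun x : X => (x, (0 : ℝ))) x₀ hPs.hasFDerivAt h1).unique hD
    exact congrArg (fun M : X →L[ℝ] X => M u) h2
  obtain ⟨s, hs, hlip⟩ := hPs.approximates_deriv_on_nhds (c := c) (Or.inr hc)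
  have hdiff : ∀ᶠ w in 𝓝 (x₀, (0 : ℝ)), DifferentiableAt ℝ R w :=
    (hR.eventually (by simp)).mono fun w hw => hw.differentiableAt two_ne_zero
  have hid' : ∀ᶠ w : X × ℝ in 𝓝 (x₀, (0 : ℝ)), R (w.1, 0) = w.1 :=
    (continuousAt_fst (p := (x₀, (0 : ℝ)))).eventually hid
  obtain ⟨ρ, hρ, hball⟩ := Metric.eventually_nhds_iff.1 (hdiff.and (hid'.and hs))
  have hmem : ∀ x ∈ Metric.ball x₀ ρ, ∀ ε : ℝ, |ε| < ρ → dist (x, ε) (x₀, 0) < ρ := by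
    intro x hx ε hε
    rw [Prod.dist_eq, max_lt_iff]
    exact ⟨hx, by simpa using hε⟩
  refine ⟨ρ, hρ, fun ε hε0 hε x hx y hy => ?_⟩
  have hder : ∀ x ∈ Metric.ball x₀ ρ, ∀ r : ℝ, |r| < ρ →
      HasDerivAt (fun r : ℝ => R (x, r)) (P (x, r)) r := by
    intro x hx r hr
    have h1 : HasDerivAt (fun r : ℝ => (x, r)) ((0 : X), (1 : ℝ)) r :=
      (hasDerivAt_const r x).prodMk (hasDerivAt_id r)
    exact HasFDerivAt.comp_hasDerivAt (f := fun r : ℝ => (x, r)) r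
      (hball (hmem x hx r hr)).1.hasFDerivAt h1
  have hconv : Convex ℝ (Metric.ball (0 : ℝ) ρ) := convex_ball 0 ρ
  have key := hconv.norm_image_sub_le_of_norm_hasDerivWithin_le
    (f := fun r : ℝ => R (x, r) - R (y, r) - r • D (x - y))
    (f' := fun r : ℝ => P (x, r) - P (y, r) - D (x - y)) (C := c * ‖x - y‖)
    (fun r hr => by
      have hr' : |r| < ρ := by simpa using hr
      have h1 : HasDerivAt (fun r : ℝ => r • D (x - y)) (D (x - y)) r := by
        simpa using (hasDerivAt_id r).smul_const (D (x - y))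
      exact (((hder x hx r hr').sub (hder y hy r hr')).sub h1).hasDerivWithinAt)
    (fun r hr => by
      have hr' : |r| < ρ := by simpa using hr
      have h1 := hlip (x, r) (hball (hmem x hx r hr')).2.2 (y, r) (hball (hmem y hy r hr')).2.2
      rw [Prod.mk_sub_mk, sub_self, hPD] at h1
      refine h1.trans (le_of_eq ?_)
      simp [Prod.norm_def])
    (Metric.mem_ball_self hρ) (by simpa using hε : ε ∈ Metric.ball (0 : ℝ) ρ)
  have hx0 : R (x, 0) = x := (hball (hmem x hx 0 (by simpa using hρ))).2.1
  have hy0 : R (y, 0) = y := (hball (hmem y hy 0 (by simpa using hρ))).2.1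
  have heq : ε⁻¹ • (R (x, ε) - x) - ε⁻¹ • (R (y, ε) - y) - D (x - y) =
      ε⁻¹ • (R (x, ε) - R (y, ε) - ε • D (x - y)
        - (R (x, 0) - R (y, 0) - (0 : ℝ) • D (x - y))) := by
    rw [hx0, hy0, zero_smul, sub_zero, smul_sub, smul_sub, smul_sub, smul_sub, smul_smul,
      inv_mul_cancel₀ hε0, one_smul, smul_sub, smul_sub]
    abel
  rw [heq, norm_smul, norm_inv]
  rw [sub_zero] at key
  rw [inv_mul_le_iff₀ (norm_pos_iff.2 hε0), mul_comm]
  exact key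

/-- Simple zeros of the first order term of the displacement `R (x, ε) - x` continue to locally
unique fixed points of `R (·, ε)`. -/
theorem fixedPoints_of_simple_zero [CompleteSpace X] [Nontrivial X] {R : X × ℝ → X} {x₀ : X}
    (hR : ContDiffAt ℝ 2 R (x₀, 0)) (hid : ∀ᶠ x in 𝓝 x₀, R (x, 0) = x)
    (hzero : fderiv ℝ R (x₀, 0) (0, 1) = 0) {D : X ≃L[ℝ] X}
    (hD : HasFDerivAt (fun x => fderiv ℝ R (x, 0) (0, 1)) (D : X →L[ℝ] X) x₀) :
    (∃ ρ > 0, ∀ ε : ℝ, ε ≠ 0 → |ε| < ρ → ∀ x ∈ Metric.ball x₀ ρ, ∀ y ∈ Metric.ball x₀ ρ,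
      R (x, ε) = x → R (y, ε) = y → x = y) ∧
    ∀ r > 0, ∀ᶠ ε in 𝓝[≠] (0 : ℝ), ∃ x ∈ Metric.closedBall x₀ r, R (x, ε) = x := by
  set N : NNReal := ‖(D.symm : X →L[ℝ] X)‖₊ with hN
  have hNpos : 0 < N := D.nnnorm_symm_pos
  -- Any constant below 1/‖D⁻¹‖ gives injectivity and surjectivity onto a ball; half of it leaves
  -- the margin used in `hrad`.
  have hc : 0 < N⁻¹ / 2 := half_pos (inv_pos.2 hNpos)
  obtain ⟨ρ, hρ, happ⟩ := approximatesLinearOn_displacement hR hid hD hc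
  have hfix : ∀ ε : ℝ, ε ≠ 0 → ∀ x, ε⁻¹ • (R (x, ε) - x) = 0 ↔ R (x, ε) = x := fun ε hε x => by
    rw [smul_eq_zero_iff_right (inv_ne_zero hε), sub_eq_zero]
  refine ⟨⟨ρ, hρ, fun ε hε0 hε x hx y hy hfx hfy => ?_⟩, fun r hr => ?_⟩
  · refine (happ ε hε0 hε).injOn (Or.inr ?_) hx hy ?_
    · exact NNReal.half_lt_self (inv_pos.2 hNpos).ne'
    · exact ((hfix ε hε0 x).2 hfx).trans ((hfix ε hε0 y).2 hfy).symm
  · set r' := min r (ρ / 2) with hr'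
    have hr'0 : 0 < r' := lt_min hr (half_pos hρ)
    -- The value at the centre tends to 0, while the image of the ball covers a ball around it of
    -- radius independent of ε; so 0 is eventually attained.
    have hlim : Tendsto (fun ε : ℝ => ε⁻¹ • (R (x₀, ε) - x₀)) (𝓝[≠] 0) (𝓝 0) := by
      have h1 : HasDerivAt (fun ε : ℝ => (x₀, ε)) ((0 : X), (1 : ℝ)) 0 :=
        (hasDerivAt_const 0 x₀).prodMk (hasDerivAt_id 0)
      have h2 : HasDerivAt (fun ε : ℝ => R (x₀, ε)) (fderiv ℝ R (x₀, 0) (0, 1)) 0 :=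
        HasFDerivAt.comp_hasDerivAt (f := fun ε : ℝ => (x₀, ε)) 0
          (hR.differentiableAt two_ne_zero).hasFDerivAt h1
      rw [hzero] at h2
      have h3 := hasDerivAt_iff_tendsto_slope_zero.1 h2
      simpa [hid.self_of_nhds] using h3
    have hrad : 0 < ((N : ℝ)⁻¹ - (N⁻¹ / 2 : NNReal)) * r' := by
      refine mul_pos ?_ hr'0
      rw [NNReal.coe_div, NNReal.coe_inv, NNReal.coe_ofNat, sub_half]
      positivity
    filter_upwards [self_mem_nhdsWithin, mem_nhdsWithin_of_mem_nhds (Metric.ball_mem_nhds 0 hρ),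
      hlim.eventually (Metric.closedBall_mem_nhds 0 hrad)] with ε hε0 hε hsmall
    have hε' : |ε| < ρ := by simpa using hε
    have hsurj := (happ ε hε0 hε').surjOn_closedBall_of_nonlinearRightInverse
      D.toNonlinearRightInverse hr'0.le (b := x₀)
      (Metric.closedBall_subset_ball ((min_le_right _ _).trans_lt (half_lt_self hρ)))
    obtain ⟨x, hx, hx0⟩ := hsurj (a := 0) (by
      rw [Metric.mem_closedBall']
      exact hsmall)
    exact ⟨x, Metric.closedBall_subset_closedBall (min_le_left _ _) hx, (hfix ε hε0 x).1 hx0⟩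

end Bifurcation

/-! ### Periodic orbits near the unperturbed orbit. -/

section PeriodicOrbits

variable {m : ℕ} {f g : Fin 4 → Phase m → Phase m} {U : Set (Phase m)}
  {H : Fin 4 → Phase m → Level m} {G : Set (Level m)} {A B C E : Level m → Phase m}
  {T : Fin 4 → Level m → ℝ} {γ : Fin 4 → Level m → ℝ → Phase m} {h : Level m}

/-- A periodic orbit is determined by its point on the first piece of the switching planes. -/
theorem periodicOrbit_unique {v : Fin 4 → Phase m → Phase m} (hv : ∀ k, ContDiff ℝ 1 (v k))
    {p p' : Fin 4 → Phase m} {τ τ' : Fin 4 → ℝ} {α α' : Fin 4 → ℝ → Phase m}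
    (h : ∀ k, IsArc k (v k) (α k) (τ k) (p k) (p (k + 1)))
    (h' : ∀ k, IsArc k (v k) (α' k) (τ' k) (p' k) (p' (k + 1))) (h0 : p 0 = p' 0) :
    ⋃ k, α k '' Icc 0 (τ k) = ⋃ k, α' k '' Icc 0 (τ' k) := by
  have step : ∀ k, p k = p' k → p (k + 1) = p' (k + 1) := fun k hk =>
    ((h k).unique (hv k) (hk ▸ h' k)).2.2
  have h1 : p 1 = p' 1 := step 0 h0
  have h2 : p 2 = p' 2 := step 1 h1
  have h3 : p 3 = p' 3 := step 2 h2
  have hp : ∀ k, p k = p' k := fun k => by fin_cases k <;> assumption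
  refine iUnion_congr fun k => ?_
  obtain ⟨hτ, heq, -⟩ := (h k).unique (hv k) ((hp k) ▸ h' k)
  rw [← hτ]
  exact heq.image_eq

theorem IsPeriodicOrbit.isReturn {v : Fin 4 → Phase m → Phase m} {p : Fin 4 → Phase m}
    {τ : Fin 4 → ℝ} {α : Fin 4 → ℝ → Phase m}
    (h : ∀ k, IsArc k (v k) (α k) (τ k) (p k) (p (k + 1))) : IsReturn v (p 0) (p 0) :=
  ⟨p 1, p 2, p 3, ⟨_, _, h 0⟩, ⟨_, _, h 1⟩, ⟨_, _, h 2⟩, ⟨_, _, h 3⟩⟩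

theorem IsReturnWithin.mem_switching {v : Fin 4 → Phase m → Phase m} {S : Set (Phase m)}
    {p q : Phase m} (h : IsReturnWithin v S p q) : q ∈ switching 0 := by
  obtain ⟨x, α, τ, -, -, -, -, h3, -⟩ := h
  exact h3.end_mem

theorem IsReturnWithin.exists_isPeriodicOrbit {v : Fin 4 → Phase m → Phase m}
    {S : Set (Phase m)} {p : Phase m} (h : IsReturnWithin v S p p) :
    ∃ Γ, IsPeriodicOrbit v Γ ∧ Γ ⊆ S := by
  obtain ⟨x, α, τ, rfl, h0, h1, h2, h3, hS⟩ := h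
  refine ⟨⋃ k, α k '' Icc 0 (τ k), ⟨x, τ, α, fun k => ?_, rfl⟩, iUnion_subset hS⟩
  fin_cases k
  · exact h0
  · exact h1
  · exact h2
  · exact h3

theorem isCompact_orbit (hA2 : AssumptionA2 f U H G A B C E T γ) (hh : h ∈ G) :
    IsCompact (orbit T γ h) := by
  have key : ∀ {k : Fin 4} {p q : Phase m}, IsArc k (f k) (γ k h) (T k h) p q →
      IsCompact (γ k h '' Icc 0 (T k h)) := fun harc =>
    isCompact_Icc.image_of_continuousOn fun t ht => (harc.ode t ht).continuousWithinAt
  refine isCompact_iUnion fun k => ?_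
  fin_cases k
  · exact key (hA2.arc_AB h hh)
  · exact key (hA2.arc_BC h hh)
  · exact key (hA2.arc_CE h hh)
  · exact key (hA2.arc_EA h hh)

/-- The orbit meets the closure of the first piece of the switching planes only at `A(h)`. -/
theorem eq_A_of_mem_orbit (hA2 : AssumptionA2 f U H G A B C E T γ) (hh : h ∈ G) {x : Phase m}
    (hx : x ∈ orbit T γ h) (hx0 : x 0 = 0) (hx1 : 0 ≤ x 1) : x = A h := by
  obtain ⟨k, t, ht, rfl⟩ := mem_iUnion.1 hx
  fin_cases k
  · have harc := hA2.arc_AB h hh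
    rcases eq_or_lt_of_le ht.1 with rfl | h0
    · exact harc.start_eq
    · exact absurd hx0 (harc.entry_pos t ⟨h0, ht.2⟩).ne'
  · have harc := hA2.arc_BC h hh
    rcases eq_or_lt_of_le ht.2 with rfl | h0
    · have := harc.entry_pos _ ⟨harc.pos, le_rfl⟩
      exact absurd hx1 (not_le.2 (neg_pos.1 this))
    · exact absurd hx0 (harc.exit_pos t ⟨ht.1, h0⟩).ne'
  · have harc := hA2.arc_CE h hh
    rcases eq_or_lt_of_le ht.2 with rfl | h0
    · have := harc.entry_pos _ ⟨harc.pos, le_rfl⟩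
      exact absurd hx0 (neg_pos.1 this).ne
    · have := harc.exit_pos t ⟨ht.1, h0⟩
      exact absurd hx1 (not_le.2 (neg_pos.1 this))
  · have harc := hA2.arc_EA h hh
    rcases eq_or_lt_of_le ht.2 with rfl | h0
    · exact harc.end_eq
    · have := harc.exit_pos t ⟨ht.1, h0⟩
      exact absurd hx0 (neg_pos.1 this).ne

/-- The compact orbit misses the part of the closure of Σ_A outside the interior of V, so a
thickening misses it too. The closure is needed for a closed set, which is why `eq_A_of_mem_orbit`
allows x₂ = 0. -/
theorem exists_thickening_orbit (hA2 : AssumptionA2 f U H G A B C E T γ) (hh : h ∈ G)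
    {V : Set (Phase m)} (hV : V ∈ 𝓝 (A h)) :
    ∃ δ > 0, ∀ p ∈ Metric.thickening δ (orbit T γ h), p ∈ switching 0 → p ∈ V := by
  let S : Set (Phase m) := ({x | x 0 = 0} ∩ {x | 0 ≤ x 1}) ∩ (interior V)ᶜ
  have hS : IsClosed S :=
    ((isClosed_eq (continuous_apply 0) continuous_const).inter
      (isClosed_le continuous_const (continuous_apply 1))).inter isOpen_interior.isClosed_compl
  obtain ⟨δ, hδ, hsub⟩ := (isCompact_orbit hA2 hh).exists_thickening_subset_open hS.isOpen_compl
    (fun x hx hxS => hxS.2 (by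
      rw [eq_A_of_mem_orbit hA2 hh hx hxS.1.1 hxS.1.2]
      exact mem_interior_iff_mem_nhds.2 hV))
  refine ⟨δ, hδ, fun p hp hsw => ?_⟩
  have hsw' : p 0 = 0 ∧ 0 < p 1 := hsw
  by_contra hpV
  exact hsub hp ⟨⟨hsw'.1, hsw'.2.le⟩, fun hi => hpV (interior_subset hi)⟩

theorem hasDerivAt_displacement {R : Level m × ℝ → Level m} (hR : DifferentiableAt ℝ R (h, 0))
    (hdisp : ∀ᶠ ε in 𝓝 (0 : ℝ), displacement f g H A h ε = R (h, ε) - h) :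
    HasDerivAt (displacement f g H A h) (fderiv ℝ R (h, 0) (0, 1)) 0 := by
  have h1 : HasDerivAt (fun ε : ℝ => (h, ε)) ((0 : Level m), (1 : ℝ)) 0 :=
    (hasDerivAt_const 0 h).prodMk (hasDerivAt_id 0)
  have h2 : HasDerivAt (fun ε : ℝ => R (h, ε)) (fderiv ℝ R (h, 0) (0, 1)) 0 :=
    HasFDerivAt.comp_hasDerivAt (f := fun ε : ℝ => (h, ε)) 0 hR.hasFDerivAt h1
  exact (h2.sub_const h).congr_of_eventuallyEq hdisp

theorem melnikov_eq_deriv : melnikov f g H A h = deriv (displacement f g H A h) 0 :=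
  dslope_same _ _

end PeriodicOrbits

end PiecewiseMelnikov

end

/-! ### The theorem. -/

open PiecewiseMelnikov in
theorem theorem1p1 {m : ℕ}
    (f g : Fin 4 → Phase m → Phase m)
    (hf : ∀ k, ContDiff ℝ ∞ (f k)) (hg : ∀ k, ContDiff ℝ ∞ (g k))
    (U : Set (Phase m)) (H : Fin 4 → Phase m → Level m)
    (G : Set (Level m)) (A B C E : Level m → Phase m)
    (T : Fin 4 → Level m → ℝ) (γ : Fin 4 → Level m → ℝ → Phase m)
    (hA1 : AssumptionA1 f U H)
    (hA2 : AssumptionA2 f U H G A B C E T γ)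
    (hA3 : AssumptionA3 H G A B C E) :
    (∀ h ∈ G,
      (∀ᶠ ε in 𝓝 (0 : ℝ), ∃! q, IsReturn (perturbed f g ε) (A h) q) ∧
      DifferentiableAt ℝ (displacement f g H A h) 0 ∧
      melnikov f g H A h = melnikovFormula g H A C E T γ h) ∧
    (∀ h₀ ∈ G, melnikov f g H A h₀ = 0 → (fderiv ℝ (melnikov f g H A) h₀).det ≠ 0 →
      ∃ δ₀ > 0, ∀ δ, 0 < δ → δ ≤ δ₀ → ∃ ε₀ > 0, ∀ ε : ℝ, 0 < |ε| → |ε| < ε₀ →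
        ∃! Γ : Set (Phase m), IsPeriodicOrbit (perturbed f g ε) Γ ∧
          Γ ⊆ Metric.thickening δ (orbit T γ h₀)) := by
  refine ⟨fun h hh => ?_, fun h₀ hh₀ hM hdet => ?_⟩
  · obtain ⟨R, hR, hdisp, -, hform, hret⟩ := exists_local_return hf hg hA1 hA2 hA3 hh
    have ht : Tendsto (fun ε : ℝ => (h, ε)) (𝓝 0) (𝓝 (h, 0)) :=
      (by fun_prop : Continuous fun ε : ℝ => (h, ε)).tendsto 0
    have hd := hasDerivAt_displacement (hR.differentiableAt (by simp)) (ht.eventually hdisp)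
    refine ⟨?_, hd.differentiableAt, ?_⟩
    · filter_upwards [ht.eventually (hret 1 one_pos)] with ε hε
      obtain ⟨q, -, -, hq⟩ := hε
      exact ⟨q, hq.isReturn, fun q' hq' =>
        IsReturn.unique (contDiff_perturbed hf hg ε) hq' hq.isReturn⟩
    · rw [melnikov_eq_deriv, hd.deriv, hform]
  · obtain ⟨R, hR, hdisp, hid, -, hret⟩ := exists_local_return hf hg hA1 hA2 hA3 hh₀
    have hR2 : ContDiffAt ℝ 2 R (h₀, 0) := hR.of_le (by norm_cast)
    -- Differentiating M requires agreement on a neighbourhood of h₀; the same R serves all nearby h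
    -- because the displacement identity holds jointly in (h, ε).
    have hmel : melnikov f g H A =ᶠ[𝓝 h₀] fun h => fderiv ℝ R (h, 0) (0, 1) := by
      have hdiff : ∀ᶠ w in 𝓝 (h₀, (0 : ℝ)), DifferentiableAt ℝ R w :=
        (hR2.eventually (by simp)).mono fun w hw => hw.differentiableAt two_ne_zero
      have ht : Tendsto (fun h : Level m => (h, (0 : ℝ))) (𝓝 h₀) (𝓝 (h₀, 0)) :=
        (by fun_prop : Continuous fun h : Level m => (h, (0 : ℝ))).tendsto h₀
      rw [nhds_prod_eq] at hdisp
      filter_upwards [hdisp.curry, ht.eventually hdiff] with h h1 h2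
      rw [melnikov_eq_deriv, (hasDerivAt_displacement h2 h1).deriv]
    have hP : DifferentiableAt ℝ (fun h => fderiv ℝ R (h, 0) (0, 1)) h₀ := by
      have h1 : ContDiffAt ℝ 1 (fun w => fderiv ℝ R w (0, 1)) (h₀, 0) :=
        (hR2.fderiv_right (m := 1) (by norm_num)).clm_apply contDiffAt_const
      exact DifferentiableAt.comp (g := fun w => fderiv ℝ R w (0, 1)) h₀
        (h1.differentiableAt one_ne_zero)
        (by fun_prop : DifferentiableAt ℝ (fun h : Level m => (h, (0 : ℝ))) h₀)
    rw [hmel.fderiv_eq] at hdet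
    obtain ⟨⟨ρ, hρ, huniq⟩, hex⟩ := fixedPoints_of_simple_zero hR2 hid
      (hmel.self_of_nhds.symm.trans hM)
      (D := ContinuousLinearMap.toContinuousLinearEquivOfDetNeZero _ hdet)
      (by rw [ContinuousLinearMap.coe_toContinuousLinearEquivOfDetNeZero]; exact hP.hasFDerivAt)
    obtain ⟨ρ₁, hρ₁, hdisp₁⟩ := Metric.eventually_nhds_iff.1 hdisp
    have hAU := (hA2.mem h₀ hh₀).1
    have hV : ∀ᶠ p in 𝓝 (A h₀), p ∈ U ∧ H 0 p ∈ G ∩ Metric.ball h₀ (min ρ ρ₁) := by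
      have hc : Tendsto (H 0) (𝓝 (A h₀)) (𝓝 h₀) := by
        have := ((hA1.smooth 0).continuousOn.continuousAt (hA1.isOpen.mem_nhds hAU)).tendsto
        rwa [hA2.first_integral_A hh₀] at this
      exact (hA1.isOpen.eventually_mem hAU).and (hc.eventually
        (inter_mem (hA2.isOpen.mem_nhds hh₀) (Metric.ball_mem_nhds _ (lt_min hρ hρ₁))))
    -- The radius δ₀ is fixed by uniqueness alone. A smaller δ only restricts the radius `ρ₂` for
    -- existence, and through it ε₀.
    obtain ⟨δ₀, hδ₀, hnear⟩ := exists_thickening_orbit hA2 hh₀ hV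
    refine ⟨δ₀, hδ₀, fun δ hδ hδδ₀ => ?_⟩
    obtain ⟨ρ₂, hρ₂, hret₂⟩ := Metric.eventually_nhds_iff.1
      ((hret δ hδ).and ((continuousAt_fst (p := (h₀, (0 : ℝ)))).eventually
        (hA2.isOpen.mem_nhds hh₀)))
    obtain ⟨ε₁, hε₁, hex₁⟩ := Metric.eventually_nhds_iff.1
      (eventually_nhdsWithin_iff.1 (hex (ρ₂ / 2) (half_pos hρ₂)))
    refine ⟨min (min ρ ρ₁) (min ρ₂ ε₁), lt_min (lt_min hρ hρ₁) (lt_min hρ₂ hε₁),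
      fun ε hε0 hε => ?_⟩
    have hεne : ε ≠ 0 := abs_pos.1 hε0
    simp only [lt_min_iff] at hε
    obtain ⟨⟨hερ, hερ₁⟩, hερ₂, hεε₁⟩ := hε
    obtain ⟨h₁, hh₁, hfix⟩ := hex₁ (by simpa using hεε₁) hεne
    have hclose : dist (h₁, ε) (h₀, (0 : ℝ)) < ρ₂ := by
      rw [Prod.dist_eq, max_lt_iff]
      exact ⟨(Metric.mem_closedBall.1 hh₁).trans_lt (half_lt_self hρ₂), by simpa using hερ₂⟩
    obtain ⟨⟨q, hqU, hqR, hqret⟩, hh₁G⟩ := hret₂ hclose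
    -- A fixed level is a fixed point: the return point lies on Σ_A, in U and on the level h₁.
    obtain rfl : q = A h₁ := hA2.eq_A hh₁G hqret.mem_switching hqU (hqR.trans hfix)
    obtain ⟨Γ, hΓ, hΓsub⟩ := hqret.exists_isPeriodicOrbit
    -- Conversely, a periodic orbit in the neighbourhood crosses Σ_A near A(h₀), and the level of
    -- its crossing point is a fixed point of R(·, ε) in the ball where there is at most one.
    have hpoint : ∀ {Γ : Set (Phase m)} {p : Fin 4 → Phase m} {τ : Fin 4 → ℝ}
        {α : Fin 4 → ℝ → Phase m},
        (∀ k, IsArc k (perturbed f g ε k) (α k) (τ k) (p k) (p (k + 1))) →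
        Γ = ⋃ k, α k '' Icc 0 (τ k) → Γ ⊆ Metric.thickening δ (orbit T γ h₀) →
        ∃ h ∈ Metric.ball h₀ ρ, R (h, ε) = h ∧ p 0 = A h := by
      intro Γ p τ α harc hΓ hsub
      have hp : p 0 ∈ Metric.thickening δ (orbit T γ h₀) := by
        refine hsub ?_
        rw [hΓ]
        exact mem_iUnion.2 ⟨0, 0, left_mem_Icc.2 (harc 0).pos.le, (harc 0).start_eq⟩
      obtain ⟨hpU, hpG, hpball⟩ := hnear (p 0) (Metric.thickening_mono hδδ₀ _ hp)
        (harc 0).start_mem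
      have hpA : p 0 = A (H 0 (p 0)) := hA2.eq_A hpG (harc 0).start_mem hpU rfl
      rw [Metric.mem_ball, lt_min_iff] at hpball
      refine ⟨H 0 (p 0), hpball.1, ?_, hpA⟩
      have h1 := hdisp₁ (show dist (H 0 (p 0), ε) (h₀, (0 : ℝ)) < ρ₁ by
        rw [Prod.dist_eq, max_lt_iff]
        exact ⟨hpball.2, by simpa using hερ₁⟩)
      have h2 := returnPoint_eq (contDiff_perturbed hf hg ε) (IsPeriodicOrbit.isReturn harc)
      simp only [displacement] at h1
      rw [← hpA, h2, sub_self] at h1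
      exact (sub_eq_zero.1 h1.symm)
    refine ⟨Γ, ⟨hΓ, hΓsub⟩, ?_⟩
    rintro Γ' ⟨⟨p', τ', α', harc', hΓ'⟩, hΓ'sub⟩
    obtain ⟨p, τ, α, harc, hΓeq⟩ := hΓ
    obtain ⟨h₂, hb₂, hfix₂, hp₂⟩ := hpoint harc hΓeq hΓsub
    obtain ⟨h₃, hb₃, hfix₃, hp₃⟩ := hpoint harc' hΓ' hΓ'sub
    have heq : h₂ = h₃ := huniq ε hεne hερ h₂ hb₂ h₃ hb₃ hfix₂ hfix₃
    rw [hΓ', hΓeq]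
    exact periodicOrbit_unique (contDiff_perturbed hf hg ε) harc' harc
      (by rw [hp₃, hp₂, heq])
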